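/- Call a set $P\subset\mathbb{R}^2$ a convex integer $N$-gon if it is the convex hull of a finite set, has nonempty interior, and has exactly $N$ vertices, all of which lie in $\mathbb{Z}^2$. A lattice $\Gamma=A\mathbb{Z}^2$, where $A=(a_{ij})$ is an integer $2\times 2$ matrix with $\det A\ne 0$, is called a $(\delta,m)$-lattice if $\delta=\gcd(a_{ij})$ and $m=|\det A|/\delta$. A segment splits $P$ if it divides $P$ into two parts with nonempty interior. Let $n\ge 3$ be an integer and let $P$ be a convex integer $N$-gon containing no point of $n\mathbb{Z}^2=\{(nu_1,nu_2):u_1,u_2\in\mathbb{Z}\}$. Suppose that $P$ is of one of the following two types: - type $\mathrm{I}_n$: for some $j\in\mathbb{Z}$, $P$ lies in the slab $jn\le x_1\le (j+1)n$ or in the slab $jn\le x_2\le (j+1)n$; - type $\mathrm{II}_n$: each of the segments $[(0,0),(n,0)]$, $[(n,0),(n,n)]$, $[(0,n),(n,n)]$ and $[(0,0),(0,n)]$ splits $P$. Then: 1. $N\le 2n+2$; 2. if $n$ is even and the vertices of $P$ belong to a $(1,n/2)$-lattice, then $N\le 2n$; 3. if the vertices of $P$ belong to a $(1,n)$-lattice,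 then $N\le 2n-2$. -/

import Mathlib

/-- The set `P` is a convex polygon in the plane: the convex hull of a finite set of points
that has nonempty interior. -/
def IsConvexPolygon (P : Set (ℝ × ℝ)) : Prop :=
  (∃ s : Finset (ℝ × ℝ), P = convexHull ℝ (s : Set (ℝ × ℝ))) ∧ (interior P).Nonempty

/-- The vertices of a convex polygon are its extreme points. -/
def polygonVertices (P : Set (ℝ × ℝ)) : Set (ℝ × ℝ) :=
  P.extremePoints ℝ

/-- The integer lattice `ℤ²` in the plane. -/
def integerPoints : Set (ℝ × ℝ) :=
  {x | ∃ u v : ℤ, x = ((u : ℝ), (v : ℝ))}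

/-- The lattice `nℤ² = {(n u, n v) : u, v ∈ ℤ}`. -/
def scaledLattice (n : ℕ) : Set (ℝ × ℝ) :=
  {x | ∃ u v : ℤ, x = ((n : ℝ) * u, (n : ℝ) * v)}

/-- A convex integer `N`-gon: a convex polygon with exactly `N` vertices, all of them integer
points. -/
def IsConvexIntegerGon (N : ℕ) (P : Set (ℝ × ℝ)) : Prop :=
  IsConvexPolygon P ∧ polygonVertices P ⊆ integerPoints ∧ (polygonVertices P).ncard = N

/-- The set `A ℤ²` of integer combinations of the columns of an integer matrix `A`. -/
def columnLattice (A : Matrix (Fin 2) (Fin 2) ℤ) : Set (ℝ × ℝ) :=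
  {x | ∃ u v : ℤ,
    x = (((A 0 0 * u + A 0 1 * v : ℤ) : ℝ), ((A 1 0 * u + A 1 1 * v : ℤ) : ℝ))}

/-- `Γ` is a `(δ, n)`-lattice: a rank-two sublattice `A ℤ²` of `ℤ²` with invariant factors
`δ = gcd (a_ij)` and `n = |det A| / δ`. -/
def IsInvariantFactorLattice (δ n : ℕ) (Γ : Set (ℝ × ℝ)) : Prop :=
  ∃ A : Matrix (Fin 2) (Fin 2) ℤ, A.det ≠ 0 ∧ Γ = columnLattice A ∧
    Nat.gcd (Int.gcd (A 0 0) (A 0 1)) (Int.gcd (A 1 0) (A 1 1)) = δ ∧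
    A.det.natAbs = δ * n

/-- The determinant of `(b - a, x - a)`. For `a ≠ b` it vanishes exactly on the line through
`a` and `b`, and its sign tells the two open half-planes bounded by this line apart. -/
def lineSide (a b x : ℝ × ℝ) : ℝ :=
  (b.1 - a.1) * (x.2 - a.2) - (b.2 - a.2) * (x.1 - a.1)

/-- The segment `[a, b]` splits the convex polygon `P`, that is, it divides `P` into two parts
with nonempty interior: the whole cut of `P` by the line through `a` and `b` lies on the
segment, and the parts of `P` on the two sides of this line have nonempty interior. -/
def SegmentSplits (a b : ℝ × ℝ) (P : Set (ℝ × ℝ)) : Prop :=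
  P ∩ {x | lineSide a b x = 0} ⊆ segment ℝ a b ∧
  (interior (P ∩ {x | 0 < lineSide a b x})).Nonempty ∧
  (interior (P ∩ {x | lineSide a b x < 0})).Nonempty

/-- Type I: `P` is free of points of `nℤ²` and lies in a slab `j n ≤ x₁ ≤ (j + 1) n` or
`j n ≤ x₂ ≤ (j + 1) n` for some integer `j`. -/
def IsTypeI (n : ℕ) (P : Set (ℝ × ℝ)) : Prop :=
  Disjoint P (scaledLattice n) ∧
  ∃ j : ℤ, (∀ x ∈ P, (j : ℝ) * n ≤ x.1 ∧ x.1 ≤ ((j : ℝ) + 1) * n) ∨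
    (∀ x ∈ P, (j : ℝ) * n ≤ x.2 ∧ x.2 ≤ ((j : ℝ) + 1) * n)

/-- Type II: `P` is free of points of `nℤ²` and is split by each of the four sides of the
square with the corners `(0, 0)`, `(n, 0)`, `(n, n)`, `(0, n)`. -/
def IsTypeII (n : ℕ) (P : Set (ℝ × ℝ)) : Prop :=
  Disjoint P (scaledLattice n) ∧
  SegmentSplits (0, 0) ((n : ℝ), 0) P ∧
  SegmentSplits ((n : ℝ), 0) ((n : ℝ), (n : ℝ)) P ∧
  SegmentSplits (0, (n : ℝ)) ((n : ℝ), (n : ℝ)) P ∧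
  SegmentSplits (0, 0) (0, (n : ℝ)) P

/-! Type I is a column count: a line contains at most two vertices, and the slab has `n + 1` integer
columns. If the vertices lie in a lattice of index `m`, either one coordinate has a common divisor
at least 2, which thins out the columns, or vertices on the two boundary columns have their other
coordinate divisible by `m`. Since `P` avoids `nℤ²`, such a column then holds no vertex for `m = n`
and at most one for `n = 2m`.

Type II: perturb the linear form exposing each vertex so that both coefficients are nonzero. Their
signs distribute the vertices over four chains, one per corner of the square. With the corner moved
to the origin and the axes reflected, a chain descends, is strictly concave and passes below the
origin. If it starts at `x = -u` and ends at `y = -v`, it has at most `(u + v - k) / 2` edges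
(`DescendingChain.two_mul_card_le`). Here `k = 1` is allowed if no two vertices have determinant ±1
relative to the corner, as holds in a lattice of index at least 2; otherwise `k = 0`.

The values `u`, `v` of the four chains add up to `4n` minus the lengths of the extreme horizontal
and vertical sides. Each such side is one further edge, of length at least `κ`. Hence `2N ≤ 4n - 4k
+ 4(2 - κ)`, and `(k, κ) = (0, 1), (1, 1), (1, 2)` give the three bounds. -/

/-! ### Counting separated integers; lexicographic maxima -/

/-- Pairwise 2-separated integers in an interval `[l, h]` are at most `(h - l) / 2 + 1` in number. -/
theorem two_mul_card_le_of_separated {ι : Type*} (T : Finset ι) (f : ι → ℤ) (l h : ℤ)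
    (hl : ∀ p ∈ T, l ≤ f p) (hh : ∀ p ∈ T, f p ≤ h) (hlh : l ≤ h + 2)
    (hs : ∀ p ∈ T, ∀ q ∈ T, p ≠ q → f p + 2 ≤ f q ∨ f q + 2 ≤ f p) :
    2 * (T.card : ℤ) ≤ h - l + 2 := by
  have hcard : T.card ≤ (Finset.Icc (0 : ℤ) ((h - l) / 2)).card := by
    -- Halving the offset from `l` keeps values at distance at least 2 distinct.
    refine Finset.card_le_card_of_injOn (fun p => (f p - l) / 2) ?_ ?_
    · intro p hp
      have h1 := hl p hp
      have h2 := hh p hp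
      simp only [Finset.coe_Icc, Set.mem_Icc]
      omega
    · intro p hp q hq hpq
      by_contra hne
      have := hs p hp q hq hne
      simp only at hpq
      omega
  rw [Int.card_Icc] at hcard
  omega

/-- A finite set has a lexicographically largest point with respect to two integer functions that
together separate points. -/
theorem exists_lexMax {V : Finset (ℤ × ℤ)} (hV : V.Nonempty) (f g : ℤ × ℤ → ℤ)
    (hfg : ∀ p q, f p = f q → g p = g q → p = q) :
    ∃ a ∈ V, ∀ q ∈ V, q ≠ a → f q < f a ∨ (f q = f a ∧ g q < g a) := by
  obtain ⟨a, ha, hmax⟩ := V.exists_max_image (fun p => toLex (f p, g p)) hV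
  refine ⟨a, ha, fun q hq hne => ?_⟩
  have h := hmax q hq
  rw [Prod.Lex.toLex_le_toLex] at h
  rcases h with h | ⟨h1, h2⟩
  · exact Or.inl h
  · exact Or.inr ⟨h1, lt_of_le_of_ne h2 fun h3 => hne (hfg q a h1 h3)⟩

/-! ### Edge count for a chain below a corner -/

/-- The vertices of a strictly decreasing strictly concave chain that passes below the origin. -/
structure DescendingChain (S : Finset (ℤ × ℤ)) : Prop where
  anti : ∀ p ∈ S, ∀ q ∈ S, p.1 < q.1 → q.2 < p.2
  inj : ∀ p ∈ S, ∀ q ∈ S, p.1 = q.1 → p = q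
  conv : ∀ p ∈ S, ∀ q ∈ S, ∀ r ∈ S, p.1 < q.1 → q.1 < r.1 →
    (p.2 - q.2) * (r.1 - q.1) < (q.2 - r.2) * (q.1 - p.1)
  -- The segment from `p` to `q` meets the vertical axis strictly below the origin.
  avoid : ∀ p ∈ S, ∀ q ∈ S, p.1 < 0 → 0 ≤ q.1 → 0 < p.1 * q.2 - p.2 * q.1
  neg : ∀ p ∈ S, p.1 < 0 ∨ p.2 < 0

theorem DescendingChain.mono {S T : Finset (ℤ × ℤ)} (hS : DescendingChain S) (h : T ⊆ S) :
    DescendingChain T where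
  anti p hp q hq := hS.anti p (h hp) q (h hq)
  inj p hp q hq := hS.inj p (h hp) q (h hq)
  conv p hp q hq r hr := hS.conv p (h hp) q (h hq) r (h hr)
  avoid p hp q hq := hS.avoid p (h hp) q (h hq)
  neg p hp := hS.neg p (h hp)

/-- Reflection in the diagonal exchanges the two ends of a chain, so the turning point at slope -1
may be assumed to lie left of the origin. -/
theorem DescendingChain.swap {S : Finset (ℤ × ℤ)} (hS : DescendingChain S) :
    DescendingChain (S.image Prod.swap) := by
  have hlt : ∀ p ∈ S, ∀ q ∈ S, p.2 < q.2 → q.1 < p.1 := by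
    intro p hp q hq h
    by_contra hc
    rcases (not_lt.1 hc).lt_or_eq with h' | h'
    · have := hS.anti p hp q hq h'; omega
    · rw [hS.inj p hp q hq h'] at h; omega
  constructor
  · simp only [Finset.forall_mem_image, Prod.fst_swap, Prod.snd_swap]
    exact fun p hp q hq h => hlt p hp q hq h
  · simp only [Finset.forall_mem_image, Prod.fst_swap]
    intro p hp q hq h
    rcases lt_trichotomy p.1 q.1 with h' | h' | h'
    · have := hS.anti p hp q hq h'; omega
    · rw [hS.inj p hp q hq h']
    · have := hS.anti q hq p hp h'; omega
  · simp only [Finset.forall_mem_image, Prod.fst_swap, Prod.snd_swap]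
    intro p hp q hq r hr h1 h2
    have := hS.conv r hr q hq p hp (hlt q hq r hr h2) (hlt p hp q hq h1)
    linarith
  · simp only [Finset.forall_mem_image, Prod.fst_swap, Prod.snd_swap]
    intro p hp q hq h1 h2
    have hq1 : q.1 < 0 := (hS.neg q hq).resolve_right (not_lt.2 h2)
    rcases lt_or_ge p.1 0 with h | h
    · nlinarith
    · have := hS.avoid q hq p hp hq1 h
      linarith
  · simp only [Finset.forall_mem_image, Prod.fst_swap, Prod.snd_swap]
    exact fun p hp => (hS.neg p hp).symm

/-- If the first edge `z q` of a chain has slope at least `c`, all later slopes exceed `c`. -/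
theorem DescendingChain.slope_lt {z q : ℤ × ℤ} {U : Finset (ℤ × ℤ)} {c : ℤ}
    (hS : DescendingChain (insert z (insert q U))) (hzq : z.1 < q.1)
    (hU : ∀ p ∈ U, q.1 < p.1) (hc : c * (q.1 - z.1) ≤ z.2 - q.2) :
    ∀ p ∈ insert q U, ∀ r ∈ insert q U, p.1 < r.1 → c * (r.1 - p.1) < p.2 - r.2 := by
  have key : ∀ r ∈ U, c * (r.1 - q.1) < q.2 - r.2 := by
    intro r hr
    have h1 := hS.conv z (by simp) q (by simp) r (by simp [hr]) hzq (hU r hr)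
    have h2 := hU r hr
    refine lt_of_mul_lt_mul_right (a := q.1 - z.1) ?_ (by omega)
    nlinarith
  intro p hp r hr hpr
  rcases Finset.mem_insert.1 hp with rfl | hpU
  · rcases Finset.mem_insert.1 hr with rfl | hrU
    · omega
    · exact key r hrU
  · have hrU : r ∈ U := by
      rcases Finset.mem_insert.1 hr with rfl | hrU
      · have := hU p hpU; omega
      · exact hrU
    have h1 := hS.conv q (by simp) p (by simp [hpU]) r (by simp [hrU]) (hU p hpU) hpr
    have h2 := hU p hpU
    have h3 := key p hpU
    refine lt_of_mul_lt_mul_right (a := p.1 - q.1) ?_ (by omega)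
    nlinarith

/-- Bound for the number of edges of a chain with slopes at least `1` and above `m` that starts in
the upper left quadrant. -/
theorem DescendingChain.two_mul_card_le_of_steep (k v : ℤ) (hk : k ≤ 1) (N : ℕ) :
    ∀ (T : Finset (ℤ × ℤ)) (z : ℤ × ℤ) (m : ℤ), T.card = N → 0 ≤ m →
      DescendingChain (insert z T) → (∀ p ∈ T, z.1 < p.1) → z.1 < 0 → 0 ≤ z.2 →
      (∃ r ∈ T, 0 < r.1) → (∀ p ∈ T, p.1 - z.1 ≤ z.2 - p.2) →
      (∀ p ∈ insert z T, ∀ q ∈ insert z T, p.1 < q.1 → m * (q.1 - p.1) < p.2 - q.2) →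
      (∀ p ∈ T, -v ≤ p.2) →
      (∀ p ∈ insert z T, ∀ q ∈ insert z T, p.1 * q.2 - p.2 * q.1 = 1 → k ≤ 0) →
      2 * (T.card : ℤ) + k ≤ -z.1 + v - m := by
  -- Every edge must be paid with 2 units. Width at least 2 pays by itself; an edge of width 1 pays
  -- one unit by its width and one by raising the slope bound `m` by 1. Below the horizontal axis
  -- the vertical drops pay.
  induction N with
  | zero =>
    intro T z m hT _ _ _ _ _ hr
    obtain ⟨r, hr, -⟩ := hr
    rw [Finset.card_eq_zero.1 hT] at hr
    simp at hr
  | succ N ih =>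
    intro T z m hT hm hS hz hz1 hz2 ⟨r, hrT, hr0⟩ hone hslope hv hdet
    obtain ⟨q, hqT, hqmin⟩ := T.exists_min_image (fun p => p.1) ⟨r, hrT⟩
    obtain ⟨U, hqU, rfl⟩ : ∃ U, q ∉ U ∧ T = insert q U :=
      ⟨T.erase q, Finset.notMem_erase q T, (Finset.insert_erase hqT).symm⟩
    have hU : ∀ p ∈ U, q.1 < p.1 := by
      intro p hp
      refine lt_of_le_of_ne (hqmin p (by simp [hp])) fun h => hqU ?_
      rwa [hS.inj q (by simp) p (by simp [hp]) h]
    have hzq : z.1 < q.1 := hz q hqT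
    have hzq1 := hone q hqT
    have hslq := hslope z (by simp) q (by simp) hzq
    rw [Finset.card_insert_of_notMem hqU] at hT ⊢
    push_cast
    have hgt := hS.slope_lt hzq hU (c := 1) (by linarith)
    have hneg := hS.neg q (by simp)
    -- the vertices after `q` are 2-separated vertically
    have hcount : ∀ K : ℤ, U.Nonempty → (∀ p ∈ U, p.2 ≤ q.2 - K) →
        2 * (U.card : ℤ) ≤ q.2 - K + v + 2 := by
      intro K hne hK
      obtain ⟨p, hp⟩ := hne
      have h1 := hK p hp
      have h2 := hv p (by simp [hp])
      have := two_mul_card_le_of_separated U (fun p => p.2) (-v) (q.2 - K)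
        (fun p hp => hv p (by simp [hp])) hK (by omega) (by
          intro p hp s hs hne
          rcases lt_trichotomy p.1 s.1 with h | h | h
          · have := hgt p (by simp [hp]) s (by simp [hs]) h
            omega
          · exact absurd (hS.inj p (by simp [hp]) s (by simp [hs]) h) hne
          · have := hgt s (by simp [hs]) p (by simp [hp]) h
            omega)
      linarith
    have hdrop : ∀ p ∈ U, p.2 ≤ q.2 - (m + 1) := by
      intro p hp
      have h1 := hslope q (by simp) p (by simp [hp]) (hU p hp)
      have h2 := hU p hp
      nlinarith
    -- An edge of width 1 has integral steepness, hence at least `m + 1`, and strict concavity makes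
    -- the later edges steeper than that.
    have hdrop' : q.1 - z.1 = 1 → ∀ p ∈ U, p.2 ≤ q.2 - (m + 2) := by
      intro ha p hp
      have h0 : m + 1 ≤ z.2 - q.2 := by rw [ha] at hslq; linarith
      have h1 := hS.slope_lt hzq hU (c := m + 1) (by rw [ha]; linarith) q (by simp) p
        (by simp [hp]) (hU p hp)
      have h2 := hU p hp
      nlinarith
    rcases lt_or_ge q.1 0 with hq1 | hq1
    · have hrU : r ∈ U := by
        rcases Finset.mem_insert.1 hrT with rfl | h
        · omega
        · exact h
      rcases lt_or_ge q.2 0 with hq2 | hq2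
      · rcases eq_or_ne (q.1 - z.1) 1 with ha | ha
        · have := hcount _ ⟨r, hrU⟩ (hdrop' ha)
          omega
        · have := hcount _ ⟨r, hrU⟩ hdrop
          omega
      · have hsub : insert q U ⊆ insert z (insert q U) := Finset.subset_insert _ _
        have step : ∀ m' : ℤ, 0 ≤ m' → (∀ p ∈ insert q U, ∀ s ∈ insert q U, p.1 < s.1 →
            m' * (s.1 - p.1) < p.2 - s.2) → 2 * (U.card : ℤ) + k ≤ -q.1 + v - m' := by
          intro m' hm' hsl
          exact ih U q m' (by omega) hm' (hS.mono hsub) hU hq1 hq2 ⟨r, hrU, hr0⟩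
            (fun p hp => by
              have := hgt q (by simp) p (by simp [hp]) (hU p hp)
              omega)
            hsl (fun p hp => hv p (by simp [hp]))
            (fun p hp s hs => hdet p (hsub hp) s (hsub hs))
        rcases eq_or_ne (q.1 - z.1) 1 with ha | ha
        · have := step (m + 1) (by omega)
            (hS.slope_lt hzq hU (c := m + 1) (by rw [ha] at hslq ⊢; linarith))
          omega
        · have := step m hm fun p hp s hs => hslope p (hsub hp) s (hsub hs)
          omega
    · have hq2 : q.2 < 0 := hneg.resolve_left (not_lt.2 hq1)
      have hav := hS.avoid z (by simp) q (by simp) hz1 hq1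
      have hdzq := hdet z (by simp) q (by simp)
      rcases hq1.eq_or_lt with hq0 | hq0
      · have hrU : r ∈ U := by
          rcases Finset.mem_insert.1 hrT with rfl | h
          · omega
          · exact h
        rcases eq_or_ne (q.1 - z.1) 1 with ha | ha
        · have := hcount _ ⟨r, hrU⟩ (hdrop' ha)
          rcases eq_or_ne q.2 (-1) with hy | hy
          · have hz : z.1 = -1 := by omega
            -- `z = (-1, z.2)` and `q = (0, -1)` have determinant 1.
            have := hdzq (by rw [hz, hy, ← hq0]; ring)
            omega
          · omega
        · rcases le_or_gt k 0 with hk0 | hk0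
          · have := hcount _ ⟨r, hrU⟩ hdrop
            omega
          · rcases eq_or_ne q.2 (-1) with hy | hy
            · have := hcount (m + 2) ⟨r, hrU⟩ (by
                intro p hp
                have h1 := hU p hp
                have h2 : p.1 ≠ 1 := by
                  intro h
                  have := hdet q (by simp) p (by simp [hp]) (by rw [hy, ← hq0, h]; ring)
                  omega
                have h3 := hslope q (by simp) p (by simp [hp]) h1
                have h4 := hgt q (by simp) p (by simp [hp]) h1
                have h5 : 2 ≤ p.1 - q.1 := by omega
                rcases hm.eq_or_lt with h | h
                · omega
                · nlinarith)
              omega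
            · have := hcount _ ⟨r, hrU⟩ hdrop
              omega
      · have hbound : 2 * (U.card : ℤ) ≤ q.2 + v := by
          rcases U.eq_empty_or_nonempty with h | h
          · have := hv q (by simp)
            rw [h, Finset.card_empty]
            push_cast
            omega
          · have := hcount 2 h fun p hp => by
              have h1 := hgt q (by simp) p (by simp [hp]) (hU p hp)
              have h2 := hU p hp
              omega
            omega
        -- The edge `z q` is steeper than `m` and crosses the axis below the origin, so `q` lies
        -- below the line of slope `-m` through the origin.
        have hy : m + 1 ≤ -q.2 := by
          have h1 : m * q.1 < -q.2 := by
            refine lt_of_mul_lt_mul_right (a := q.1 - z.1) ?_ (by omega)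
            nlinarith
          nlinarith
        -- The bound can fail only for `z.1 = -1`, `q.2 = -(m + 1)`, `k = 1`. Then `z = (-1, m)` and
        -- `q = (1, -(m + 1))`, again of determinant 1.
        by_contra hcon
        have hz : z.1 = -1 := by omega
        have hy' : q.2 = -(m + 1) := by omega
        have hk1 : k = 1 := by omega
        rw [hz, hy'] at hav hslq hzq1
        have h1 : m * q.1 ≤ z.2 := by linarith
        have h2 : z.2 * q.1 ≤ m := by linarith
        have hq : q.1 = 1 := by
          by_contra hne
          have h3 : 2 ≤ q.1 := by omega
          rcases hm.eq_or_lt with h | h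
          · nlinarith
          · nlinarith
        rw [hq] at h1 h2 hzq1
        have := hdzq (by rw [hz, hy', hq]; linarith)
        omega

/-- Bound for the number of edges of a chain whose highest point in direction `(1, 1)` lies on the
left of the origin. -/
theorem DescendingChain.two_mul_card_le_of_left {S : Finset (ℤ × ℤ)} (hS : DescendingChain S)
    (u v k : ℤ) (hu : ∀ p ∈ S, -u ≤ p.1) (hv : ∀ p ∈ S, -v ≤ p.2)
    (hb : ∃ b ∈ S, 0 < b.1) (hk : k ≤ 1)
    (hdet : ∀ p ∈ S, ∀ q ∈ S, p.1 * q.2 - p.2 * q.1 = 1 → k ≤ 0)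
    (hleft : ∃ w ∈ S, w.1 < 0 ∧ ∀ p ∈ S, p.1 + p.2 ≤ w.1 + w.2) :
    2 * (S.card : ℤ) + k ≤ u + v + 2 := by
  obtain ⟨w, hw, hw1, hwmax⟩ := hleft
  obtain ⟨b, hbS, hb1⟩ := hb
  -- Taking the leftmost maximizer of `x + y` makes edges before `z` strictly flatter than 1 and
  -- edges after it of steepness at least 1.
  obtain ⟨z, hz, hzmax⟩ := exists_lexMax ⟨w, hw⟩ (fun p => p.1 + p.2) (fun p => -p.1)
    (fun p q h1 h2 => Prod.ext (by omega) (by omega))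
  have hz1 : z.1 < 0 := by
    rcases eq_or_ne w z with rfl | h
    · exact hw1
    · have h1 := hzmax w hw h
      have h2 := hwmax z hz
      omega
  set L := S.filter fun p => p.1 ≤ z.1 with hL
  set T := S.filter fun p => ¬ p.1 ≤ z.1 with hT
  have hcard : L.card + T.card = S.card := Finset.card_filter_add_card_filter_not _
  have hTS : insert z T ⊆ S := Finset.insert_subset hz (Finset.filter_subset _ _)
  have hTz : ∀ p ∈ T, z.1 < p.1 := fun p hp => not_le.1 (Finset.mem_filter.1 hp).2
  have hTS' : ∀ p ∈ T, p ∈ S := fun p hp => (Finset.mem_filter.1 hp).1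
  have hbT : b ∈ T := Finset.mem_filter.2 ⟨hbS, by omega⟩
  -- Left of `z` an edge drops by at least 1 with steepness below 1, so its width is at least 2.
  have hgap : ∀ p ∈ L, ∀ q ∈ L, p.1 < q.1 → p.1 + 2 ≤ q.1 := by
    intro p hp q hq hpq
    obtain ⟨hpS, hp1⟩ := Finset.mem_filter.1 hp
    obtain ⟨hqS, hq1⟩ := Finset.mem_filter.1 hq
    have h1 := hS.anti p hpS q hqS hpq
    rcases eq_or_ne q z with rfl | hne
    · have := hzmax p hpS (fun h => by rw [h] at hpq; omega)
      omega
    · have h2 := hzmax q hqS hne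
      have hq1' : q.1 < z.1 := lt_of_le_of_ne hq1 fun h => hne (hS.inj q hqS z hz h)
      have h3 := hS.conv p hpS q hqS z hz hpq hq1'
      by_contra hcon
      have h4 : q.1 - p.1 = 1 := by omega
      have h5 : q.2 - z.2 < z.1 - q.1 := by omega
      rw [h4] at h3
      nlinarith
  have hLcard : 2 * (L.card : ℤ) ≤ z.1 + u + 2 := by
    have := two_mul_card_le_of_separated L (fun p => p.1) (-u) z.1
      (fun p hp => hu p (Finset.mem_filter.1 hp).1) (fun p hp => (Finset.mem_filter.1 hp).2)
      (by have := hu z hz; omega) (by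
        intro p hp q hq hne
        rcases lt_trichotomy p.1 q.1 with h | h | h
        · exact Or.inl (hgap p hp q hq h)
        · exact absurd
            (hS.inj p (Finset.mem_filter.1 hp).1 q (Finset.mem_filter.1 hq).1 h) hne
        · exact Or.inr (hgap q hq p hp h))
    linarith
  have hone : ∀ p ∈ T, p.1 - z.1 ≤ z.2 - p.2 := by
    intro p hp
    have h1 := hTz p hp
    have h2 := hzmax p (hTS' p hp) (fun h => by rw [h] at h1; omega)
    omega
  rcases lt_or_ge z.2 0 with hz2 | hz2
  -- Only the first edge after `z` can have steepness exactly 1; the later ones are steeper and drop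
  -- by at least 2.
  · have hstep : ∀ p ∈ T, ∀ q ∈ T, p.1 < q.1 → q.2 + 2 ≤ p.2 := by
      intro p hp q hq hpq
      have h1 := hone p hp
      have h2 := hTz p hp
      have h3 := hS.conv z hz p (hTS' p hp) q (hTS' q hq) h2 hpq
      have h4 : q.1 - p.1 < p.2 - q.2 := by
        refine lt_of_mul_lt_mul_right (a := p.1 - z.1) ?_ (by omega)
        nlinarith
      omega
    have hzv : ∀ p ∈ T, p.2 ≤ z.2 - 1 := fun p hp => by
      have := hS.anti z hz p (hTS' p hp) (hTz p hp)
      omega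
    have := two_mul_card_le_of_separated T (fun p => p.2) (-v) (z.2 - 1)
      (fun p hp => hv p (hTS' p hp)) hzv (by have := hv z hz; omega) (by
        intro p hp q hq hne
        rcases lt_trichotomy p.1 q.1 with h | h | h
        · exact Or.inr (hstep p hp q hq h)
        · exact absurd (hS.inj p (hTS' p hp) q (hTS' q hq) h) hne
        · exact Or.inl (hstep q hq p hp h))
    omega
  · have := DescendingChain.two_mul_card_le_of_steep k v hk T.card T z 0 rfl le_rfl
      (hS.mono hTS) hTz hz1 hz2 ⟨b, hbT, hb1⟩ hone
      (fun p hp q hq h => by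
        have := hS.anti p (hTS hp) q (hTS hq) h
        omega)
      (fun p hp => hv p (hTS' p hp)) (fun p hp q hq => hdet p (hTS hp) q (hTS hq))
    omega

/-- A chain that starts above and left of the origin at `x = -u`, passes below the origin and ends
at `y = -v` has at most `(u + v) / 2` edges; there is a further gain if its vertices span a lattice
of index at least two. -/
theorem DescendingChain.two_mul_card_le {S : Finset (ℤ × ℤ)} (hS : DescendingChain S)
    (u v k : ℤ) (hu : ∀ p ∈ S, -u ≤ p.1) (hv : ∀ p ∈ S, -v ≤ p.2)
    (ha : ∃ a ∈ S, 0 < a.2) (hb : ∃ b ∈ S, 0 < b.1) (hk : k ≤ 1)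
    (hdet : ∀ p ∈ S, ∀ q ∈ S, (p.1 * q.2 - p.2 * q.1).natAbs = 1 → k ≤ 0) :
    2 * (S.card : ℤ) + k ≤ u + v + 2 := by
  obtain ⟨b, hbS, hb1⟩ := hb
  obtain ⟨w, hw, hwmax⟩ := S.exists_max_image (fun p => p.1 + p.2) ⟨b, hbS⟩
  -- If the maximizer is not left of the origin it is below it, and the reflected chain applies.
  -- Reflection changes the sign of determinants, hence the absolute value in `hdet`.
  rcases hS.neg w hw with hw1 | hw1
  · exact hS.two_mul_card_le_of_left u v k hu hv ⟨b, hbS, hb1⟩ hk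
      (fun p hp q hq h => hdet p hp q hq (by omega)) ⟨w, hw, hw1, hwmax⟩
  · have := hS.swap.two_mul_card_le_of_left v u k (Finset.forall_mem_image.2 hv)
      (Finset.forall_mem_image.2 hu)
      (by obtain ⟨a, ha, ha2⟩ := ha
          exact ⟨a.swap, Finset.mem_image_of_mem _ ha, ha2⟩) hk
      (by
        simp only [Finset.forall_mem_image, Prod.fst_swap, Prod.snd_swap]
        exact fun p hp q hq h => hdet p hp q hq (by
          have : p.1 * q.2 - p.2 * q.1 = -1 := by linarith
          omega))
      ⟨w.swap, Finset.mem_image_of_mem _ hw, hw1, by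
        simp only [Finset.forall_mem_image, Prod.fst_swap, Prod.snd_swap]
        intro p hp
        have := hwmax p hp
        omega⟩
    rw [Finset.card_image_of_injective _ Prod.swap_injective] at this
    omega

/-! ### From exposing linear forms to the four chains -/

/-- A point to the right of `p` and not below it would not decrease a form with positive
coefficients. For concavity, the two inequalities at the middle point are weighted so that `α`
cancels. -/
theorem DescendingChain.of_exposed {S : Finset (ℤ × ℤ)}
    (hS : ∀ p ∈ S, ∃ α β : ℝ, 0 < α ∧ 0 < β ∧ ∀ q ∈ S, q ≠ p →
      α * ((q.1 : ℝ) - p.1) + β * ((q.2 : ℝ) - p.2) < 0)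
    (avoid : ∀ p ∈ S, ∀ q ∈ S, p.1 < 0 → 0 ≤ q.1 → 0 < p.1 * q.2 - p.2 * q.1)
    (neg : ∀ p ∈ S, p.1 < 0 ∨ p.2 < 0) : DescendingChain S where
  anti p hp q hq hpq := by
    obtain ⟨α, β, hα, hβ, h⟩ := hS p hp
    have h1 := h q hq (by rintro rfl; omega)
    have h2 : (p.1 : ℝ) < q.1 := by exact_mod_cast hpq
    by_contra hcon
    have h3 : (p.2 : ℝ) ≤ q.2 := by exact_mod_cast not_lt.1 hcon
    nlinarith [mul_pos hα (sub_pos.2 h2), mul_nonneg hβ.le (sub_nonneg.2 h3)]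
  inj p hp q hq hpq := by
    by_contra hne
    obtain ⟨α, β, hα, hβ, h⟩ := hS p hp
    obtain ⟨α', β', hα', hβ', h'⟩ := hS q hq
    have h1 := h q hq (Ne.symm hne)
    have h2 := h' p hp hne
    rw [hpq, sub_self, mul_zero, zero_add] at h1 h2
    have h3 := neg_of_mul_neg_right h1 hβ.le
    have h4 := neg_of_mul_neg_right h2 hβ'.le
    linarith
  conv p hp q hq r hr hpq hqr := by
    obtain ⟨α, β, hα, hβ, h⟩ := hS q hq
    have h1 := h p hp (by rintro rfl; omega)
    have h2 := h r hr (by rintro rfl; omega)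
    have h3 : (p.1 : ℝ) < q.1 := by exact_mod_cast hpq
    have h4 : (q.1 : ℝ) < r.1 := by exact_mod_cast hqr
    have h5 : ((p.2 : ℝ) - q.2) * (r.1 - q.1) < (q.2 - r.2) * (q.1 - p.1) := by
      refine lt_of_mul_lt_mul_left (a := β) ?_ hβ.le
      nlinarith [mul_pos (sub_pos.2 h3) (sub_pos.2 h4)]
    exact_mod_cast h5
  avoid := avoid
  neg := neg

/-- Every point of `V` is the unique maximizer on `V` of a linear form with nonzero coefficients. -/
def StrictlyExposed (V : Finset (ℤ × ℤ)) : Prop :=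
  ∀ p ∈ V, ∃ α β : ℝ, α ≠ 0 ∧ β ≠ 0 ∧ ∀ q ∈ V, q ≠ p →
    α * ((q.1 : ℝ) - p.1) + β * ((q.2 : ℝ) - p.2) < 0

open Classical in
/-- The points of `V` at which a linear form with coefficients of the signs `s`, `t` has its unique
maximum on `V`. -/
noncomputable def quadrantChain (V : Finset (ℤ × ℤ)) (s t : ℤ) : Finset (ℤ × ℤ) :=
  V.filter fun p => ∃ α β : ℝ, 0 < α ∧ 0 < β ∧ ∀ q ∈ V, q ≠ p →
    α * (s * ((q.1 : ℝ) - p.1)) + β * (t * ((q.2 : ℝ) - p.2)) < 0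

theorem mem_quadrantChain_iff {V : Finset (ℤ × ℤ)} {s t : ℤ} {p : ℤ × ℤ} :
    p ∈ quadrantChain V s t ↔ p ∈ V ∧ ∃ α β : ℝ, 0 < α ∧ 0 < β ∧ ∀ q ∈ V, q ≠ p →
      α * (s * ((q.1 : ℝ) - p.1)) + β * (t * ((q.2 : ℝ) - p.2)) < 0 := by
  simp [quadrantChain]

theorem StrictlyExposed.mem_quadrantChain {V : Finset (ℤ × ℤ)} (hV : StrictlyExposed V)
    {p : ℤ × ℤ} (hp : p ∈ V) : p ∈ quadrantChain V 1 1 ∨ p ∈ quadrantChain V 1 (-1) ∨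
      p ∈ quadrantChain V (-1) (-1) ∨ p ∈ quadrantChain V (-1) 1 := by
  obtain ⟨α, β, hα, hβ, h⟩ := hV p hp
  simp only [mem_quadrantChain_iff, hp, true_and]
  rcases hα.lt_or_gt with hα | hα <;> rcases hβ.lt_or_gt with hβ | hβ
  · exact Or.inr (Or.inr (Or.inl ⟨-α, -β, by linarith, by linarith, fun q hq hne => by
      have := h q hq hne
      push_cast
      linarith⟩))
  · exact Or.inr (Or.inr (Or.inr ⟨-α, β, by linarith, by linarith, fun q hq hne => by
      have := h q hq hne
      push_cast
      linarith⟩))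
  · exact Or.inr (Or.inl ⟨α, -β, by linarith, by linarith, fun q hq hne => by
      have := h q hq hne
      push_cast
      linarith⟩)
  · exact Or.inl ⟨α, β, by linarith, by linarith, fun q hq hne => by
      have := h q hq hne
      push_cast
      linarith⟩

open Filter Topology in
/-- The lexicographic maximum of two real functions on a finite set is the unique maximum of a
positive combination of them. -/
theorem exists_pos_combination {ι : Type*} (V : Finset ι) (a : ι) (f g : ι → ℝ)
    (h : ∀ q ∈ V, q ≠ a → f q < f a ∨ (f q = f a ∧ g q < g a)) :
    ∃ ε : ℝ, 0 < ε ∧ ∀ q ∈ V, q ≠ a → ε * (g q - g a) + (f q - f a) < 0 := by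
  -- For small `ε > 0` the strict inequalities in `f` persist, and ties are decided by `g`.
  have hev : ∀ᶠ ε : ℝ in 𝓝[>] 0, ∀ q ∈ V, q ≠ a → ε * (g q - g a) + (f q - f a) < 0 := by
    rw [Filter.eventually_all_finset]
    intro q hq
    rcases eq_or_ne q a with rfl | hne
    · simp
    · rcases h q hq hne with h1 | ⟨h1, h2⟩
      · have hc : Tendsto (fun ε : ℝ => ε * (g q - g a) + (f q - f a)) (𝓝 0)
            (𝓝 (0 * (g q - g a) + (f q - f a))) :=
          Continuous.tendsto (by fun_prop) 0
        filter_upwards [(hc.mono_left nhdsWithin_le_nhds).eventually_lt_const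
          (show 0 * (g q - g a) + (f q - f a) < 0 by linarith)] with ε hε _ using hε
      · filter_upwards [self_mem_nhdsWithin] with ε hε _
        have : ε * (g q - g a) < 0 := mul_neg_of_pos_of_neg hε (by linarith)
        linarith
  obtain ⟨ε, hε, hpos⟩ := (hev.and self_mem_nhdsWithin).exists
  exact ⟨ε, hpos, hε⟩

/-- The vertices of one quadrant chain of `V` near a corner `c` that the convex hull of `V` avoids
as described by `hv` and `hh`. -/
theorem two_mul_card_quadrantChain_le (V : Finset (ℤ × ℤ)) (s t : ℤ) (hs : s.natAbs = 1)
    (ht : t.natAbs = 1) (c a b : ℤ × ℤ) (k : ℤ) (X Y : ℤ × ℤ → ℤ)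
    (hX : ∀ p, X p = s * (p.1 - c.1)) (hY : ∀ p, Y p = t * (p.2 - c.2))
    (hv : ∀ p ∈ V, ∀ q ∈ V, X p < 0 → 0 ≤ X q → 0 < X p * Y q - Y p * X q)
    (hh : ∀ p ∈ V, ∀ q ∈ V, Y p < 0 → 0 ≤ Y q → 0 < Y p * X q - X p * Y q)
    (hl : ∃ l ∈ V, X l < 0)
    (ha : a ∈ V) (hamax : ∀ q ∈ V, q ≠ a → Y q < Y a ∨ (Y q = Y a ∧ X q < X a)) (ha0 : 0 < Y a)
    (hb : b ∈ V) (hbmax : ∀ q ∈ V, q ≠ b → X q < X b ∨ (X q = X b ∧ Y q < Y b)) (hb0 : 0 < X b)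
    (hk : k ≤ 1)
    (hdet : ∀ p ∈ V, ∀ q ∈ V, (X p * Y q - Y p * X q).natAbs = 1 → k ≤ 0) :
    a ∈ quadrantChain V s t ∧ b ∈ quadrantChain V s t ∧ a ≠ b ∧
      2 * ((quadrantChain V s t).card : ℤ) + k ≤ -X a - Y b + 2 := by
  set S := quadrantChain V s t with hSdef
  have hSV : ∀ p ∈ S, p ∈ V := fun p hp => (mem_quadrantChain_iff.1 hp).1
  have hXr : ∀ p q : ℤ × ℤ, (s : ℝ) * ((q.1 : ℝ) - p.1) = X q - X p := by
    intro p q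
    rw [hX, hX]
    push_cast
    ring
  have hYr : ∀ p q : ℤ × ℤ, (t : ℝ) * ((q.2 : ℝ) - p.2) = Y q - Y p := by
    intro p q
    rw [hY, hY]
    push_cast
    ring
  have hmem : ∀ p, p ∈ S ↔ p ∈ V ∧ ∃ α β : ℝ, 0 < α ∧ 0 < β ∧ ∀ q ∈ V, q ≠ p →
      α * ((X q : ℝ) - X p) + β * ((Y q : ℝ) - Y p) < 0 := by
    intro p
    simp only [hSdef, mem_quadrantChain_iff, hXr, hYr]
  have haS : a ∈ S := by
    obtain ⟨ε, hε, h⟩ := exists_pos_combination V a (fun p => (Y p : ℝ)) (fun p => (X p : ℝ))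
      (by exact_mod_cast hamax)
    exact (hmem a).2 ⟨ha, ε, 1, hε, one_pos, fun q hq hne => by linarith [h q hq hne]⟩
  have hbS : b ∈ S := by
    obtain ⟨ε, hε, h⟩ := exists_pos_combination V b (fun p => (X p : ℝ)) (fun p => (Y p : ℝ))
      (by exact_mod_cast hbmax)
    exact (hmem b).2 ⟨hb, 1, ε, one_pos, hε, fun q hq hne => by linarith [h q hq hne]⟩
  -- If `p` were in the closed quadrant at the corner, the segment from `l` to `p` would pass the
  -- corner on the side excluded by `hv` or `hh`.
  have hneg : ∀ p ∈ V, X p < 0 ∨ Y p < 0 := by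
    intro p hp
    by_contra hcon
    obtain ⟨h1, h2⟩ := not_or.1 hcon
    obtain ⟨l, hlV, hl0⟩ := hl
    have h3 := hv l hlV p hp hl0 (not_lt.1 h1)
    rcases lt_or_ge (Y l) 0 with h | h
    · have := hh l hlV p hp h (not_lt.1 h2)
      linarith
    · nlinarith
  have hab : a ≠ b := by
    rintro rfl
    rcases hneg a ha with h | h <;> omega
  refine ⟨haS, hbS, hab, ?_⟩
  have hinj : Function.Injective fun p : ℤ × ℤ => (X p, Y p) := by
    intro p q h
    simp only [Prod.mk.injEq, hX, hY] at h
    obtain ⟨h1, h2⟩ := h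
    have h3 := mul_left_cancel₀ (by omega) h1
    have h4 := mul_left_cancel₀ (by omega) h2
    exact Prod.ext (by omega) (by omega)
  have hchain : DescendingChain (S.image fun p => (X p, Y p)) := by
    apply DescendingChain.of_exposed
    · simp only [Finset.forall_mem_image]
      intro p hp
      obtain ⟨-, α, β, hα, hβ, h⟩ := (hmem p).1 hp
      exact ⟨α, β, hα, hβ, fun q hq hne => h q (hSV q hq) (by rintro rfl; exact hne rfl)⟩
    · simp only [Finset.forall_mem_image]
      exact fun p hp q hq => hv p (hSV p hp) q (hSV q hq)
    · simp only [Finset.forall_mem_image]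
      exact fun p hp => hneg p (hSV p hp)
  have ha' : (X a, Y a) ∈ S.image fun p => (X p, Y p) := Finset.mem_image_of_mem _ haS
  have hb' : (X b, Y b) ∈ S.image fun p => (X p, Y p) := Finset.mem_image_of_mem _ hbS
  -- On a descending chain the highest point `a` is leftmost and the rightmost point `b` is lowest.
  have := hchain.two_mul_card_le (-X a) (-Y b) k
    (fun p hp => by
      by_contra hcon
      have h1 := hchain.anti p hp _ ha' (by simp only; omega)
      obtain ⟨q, hq, rfl⟩ := Finset.mem_image.1 hp
      have h2 := hamax q (hSV q hq) (by rintro rfl; simp at h1)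
      simp only at h1
      omega)
    (fun p hp => by
      by_contra hcon
      obtain ⟨q, hq, rfl⟩ := Finset.mem_image.1 hp
      have h2 := hbmax q (hSV q hq) (by rintro rfl; simp at hcon)
      have h1 := hchain.anti _ hp _ hb'
      have h3 := hchain.inj _ hp _ hb'
      simp only [Prod.mk.injEq] at h1 h3 hcon
      omega)
    ⟨_, ha', ha0⟩ ⟨_, hb', hb0⟩ hk
    (by
      simp only [Finset.forall_mem_image]
      exact fun p hp q hq => hdet p (hSV p hp) q (hSV q hq))
  rw [Finset.card_image_of_injective _ hinj] at this
  linarith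

/-- The count of a set covered by four chains arranged in a cycle, the last element `bᵢ` of each of
which may coincide with the first element `aᵢ₊₁` of the next one. -/
theorem card_le_of_cyclic_cover {α : Type*} [DecidableEq α] {V S₁ S₂ S₃ S₄ : Finset α}
    {a₁ a₂ a₃ a₄ b₁ b₂ b₃ b₄ : α}
    (hV : ∀ p ∈ V, p ∈ S₁ ∨ p ∈ S₂ ∨ p ∈ S₃ ∨ p ∈ S₄)
    (hb₁ : b₁ ∈ S₁) (ha₂ : a₂ ∈ S₂) (h₂ : a₂ ≠ b₂) (hb₂ : b₂ ∈ S₂) (ha₃ : a₃ ∈ S₃) (h₃ : a₃ ≠ b₃)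
    (hb₃ : b₃ ∈ S₃) (ha₄ : a₄ ∈ S₄) (h₄ : a₄ ≠ b₄) (hb₄ : b₄ ∈ S₄) (ha₁ : a₁ ∈ S₁)
    (h₁ : a₁ ≠ b₁) :
    V.card + 4 ≤ S₁.card + S₂.card + S₃.card + S₄.card + (if b₁ = a₂ then 0 else 1) +
      (if b₂ = a₃ then 0 else 1) + (if b₃ = a₄ then 0 else 1) + (if b₄ = a₁ then 0 else 1) := by
  set extra : α → α → Finset α := fun p q => if p = q then ∅ else {p} with hextra
  have hex : ∀ p q, (extra p q).card = if p = q then 0 else 1 := by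
    intro p q
    by_cases h : p = q <;> simp [hextra, h]
  have hend : ∀ {S S' : Finset α} {b a b' p : α}, p ∈ S → a ∈ S' → a ≠ b' →
      p ∈ S.erase b ∨ p ∈ S'.erase b' ∨ p ∈ extra b a := by
    intro S S' b a b' p hp ha hab
    rcases eq_or_ne p b with rfl | h
    · rcases eq_or_ne p a with rfl | h'
      · exact Or.inr (Or.inl (Finset.mem_erase.2 ⟨hab, ha⟩))
      · exact Or.inr (Or.inr (by simp [hextra, h']))
    · exact Or.inl (Finset.mem_erase.2 ⟨h, hp⟩)
  -- A removed last element `bᵢ` reappears as the first element of the next chain, or is kept in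
  -- `extra`.
  have hcover : V ⊆ S₁.erase b₁ ∪ S₂.erase b₂ ∪ S₃.erase b₃ ∪ S₄.erase b₄ ∪
      extra b₁ a₂ ∪ extra b₂ a₃ ∪ extra b₃ a₄ ∪ extra b₄ a₁ := by
    intro p hp
    simp only [Finset.mem_union]
    rcases hV p hp with h | h | h | h
    · have := hend (b := b₁) h ha₂ h₂
      tauto
    · have := hend (b := b₂) h ha₃ h₃
      tauto
    · have := hend (b := b₃) h ha₄ h₄
      tauto
    · have := hend (b := b₄) h ha₁ h₁
      tauto
  have hcard : V.card ≤ (S₁.erase b₁).card + (S₂.erase b₂).card + (S₃.erase b₃).card +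
      (S₄.erase b₄).card + (extra b₁ a₂).card + (extra b₂ a₃).card + (extra b₃ a₄).card +
      (extra b₄ a₁).card := by
    refine (Finset.card_le_card hcover).trans ?_
    iterate 6 refine (Finset.card_union_le _ _).trans (Nat.add_le_add_right ?_ _)
    exact Finset.card_union_le _ _
  simp only [hex] at hcard
  have e₁ := Finset.card_erase_add_one hb₁
  have e₂ := Finset.card_erase_add_one hb₂
  have e₃ := Finset.card_erase_add_one hb₃
  have e₄ := Finset.card_erase_add_one hb₄
  omega

/-! ### Polygons split by the sides of a square -/

/-- The integer points `V` are the vertices of a polygon that is split by the four sides of the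
square `[0, n]²`: there are vertices beyond each side, and the segment joining two vertices on
different sides of one of the lines `x = 0`, `x = n`, `y = 0`, `y = n` meets that line inside a side
of the square. -/
structure SplitBySquare (V : Finset (ℤ × ℤ)) (n : ℤ) : Prop where
  -- The middle quantity is the height of the crossing point times `q.1 - p.1`; the `- 0` keeps the
  -- shape of `crossing_of_convex`.
  x0 : ∀ p ∈ V, ∀ q ∈ V, p.1 ≤ 0 → 0 ≤ q.1 → p.1 < q.1 →
    0 < p.2 * (q.1 - 0) - (p.1 - 0) * q.2 ∧ p.2 * (q.1 - 0) - (p.1 - 0) * q.2 < n * (q.1 - p.1)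
  xn : ∀ p ∈ V, ∀ q ∈ V, p.1 ≤ n → n ≤ q.1 → p.1 < q.1 →
    0 < p.2 * (q.1 - n) - (p.1 - n) * q.2 ∧ p.2 * (q.1 - n) - (p.1 - n) * q.2 < n * (q.1 - p.1)
  y0 : ∀ p ∈ V, ∀ q ∈ V, p.2 ≤ 0 → 0 ≤ q.2 → p.2 < q.2 →
    0 < p.1 * (q.2 - 0) - (p.2 - 0) * q.1 ∧ p.1 * (q.2 - 0) - (p.2 - 0) * q.1 < n * (q.2 - p.2)
  yn : ∀ p ∈ V, ∀ q ∈ V, p.2 ≤ n → n ≤ q.2 → p.2 < q.2 →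
    0 < p.1 * (q.2 - n) - (p.2 - n) * q.1 ∧ p.1 * (q.2 - n) - (p.2 - n) * q.1 < n * (q.2 - p.2)
  right : ∃ p ∈ V, n < p.1
  left : ∃ p ∈ V, p.1 < 0
  top : ∃ p ∈ V, n < p.2
  bottom : ∃ p ∈ V, p.2 < 0

/-- If `r` were at or below height 0, the segment to a left vertex, crossing `x = n` above 0, would
cross `y = 0` at or beyond `x = n`. The top side is similar. -/
theorem SplitBySquare.snd_mem {V : Finset (ℤ × ℤ)} {n : ℤ} (h : SplitBySquare V n) (hn : 0 < n)
    {r : ℤ × ℤ} (hr : r ∈ V) (hr1 : n < r.1) : 0 < r.2 ∧ r.2 < n := by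
  obtain ⟨l, hl, hl1⟩ := h.left
  have h1 := h.xn l hl r hr (by omega) hr1.le (by omega)
  constructor <;> by_contra hcon
  · have h2 : 0 < l.2 := by nlinarith
    have := (h.y0 r hr l hl (by omega) h2.le (by omega)).2
    linarith
  · have h2 : l.2 < n := by nlinarith
    have := (h.yn l hl r hr h2.le (by omega) (by omega)).2
    linarith

theorem SplitBySquare.fst_mem {V : Finset (ℤ × ℤ)} {n : ℤ} (h : SplitBySquare V n) (hn : 0 < n)
    {r : ℤ × ℤ} (hr : r ∈ V) (hr1 : n < r.2) : 0 < r.1 ∧ r.1 < n := by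
  obtain ⟨l, hl, hl1⟩ := h.bottom
  have h1 := h.yn l hl r hr (by omega) hr1.le (by omega)
  constructor <;> by_contra hcon
  · have h2 : 0 < l.1 := by nlinarith
    have := (h.x0 r hr l hl (by omega) h2.le (by omega)).2
    linarith
  · have h2 : l.1 < n := by nlinarith
    have := (h.xn l hl r hr h2.le (by omega) (by omega)).2
    linarith

/-- The bound for the number of vertices of a polygon split by the sides of the square `[0, n]²`. -/
theorem SplitBySquare.two_mul_card_le {V : Finset (ℤ × ℤ)} {n : ℤ} (h : SplitBySquare V n)
    (hV : StrictlyExposed V) (k κ : ℤ) (hn : 0 < n)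
    (hk : k ≤ 1)
    (hdet : ∀ p ∈ V, ∀ q ∈ V, ∀ a b : ℤ, (a = 0 ∨ a = n) → (b = 0 ∨ b = n) →
      ((p.1 - a) * (q.2 - b) - (p.2 - b) * (q.1 - a)).natAbs = 1 → k ≤ 0)
    (hκ : 1 ≤ κ) (hκ2 : κ ≤ 2)
    (hhor : ∀ p ∈ V, ∀ q ∈ V, p.2 = q.2 → p.1 < q.1 → p.1 + κ ≤ q.1)
    (hver : ∀ p ∈ V, ∀ q ∈ V, p.1 = q.1 → p.2 < q.2 → p.2 + κ ≤ q.2) :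
    2 * (V.card : ℤ) + 4 * k + 4 * κ ≤ 4 * n + 8 := by
  classical
  obtain ⟨hx0, hxn, hy0, hyn, ⟨pR, hpR, hpR'⟩, ⟨pL, hpL, hpL'⟩, ⟨pT, hpT, hpT'⟩,
    ⟨pB, hpB, hpB'⟩⟩ := h
  have hne : V.Nonempty := ⟨pR, hpR⟩
  -- Eight extreme vertices: the first letter of each name is the side, the second the tie-break, so
  -- `rt` is the top one of the rightmost vertices.
  have lex : ∀ s t : ℤ, s.natAbs = 1 → t.natAbs = 1 →
      (∃ a ∈ V, ∀ q ∈ V, q ≠ a → s * q.1 < s * a.1 ∨ (s * q.1 = s * a.1 ∧ t * q.2 < t * a.2)) ∧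
      (∃ a ∈ V, ∀ q ∈ V, q ≠ a → t * q.2 < t * a.2 ∨ (t * q.2 = t * a.2 ∧ s * q.1 < s * a.1)) := by
    intro s t hs ht
    constructor
    · exact exists_lexMax hne (fun p => s * p.1) (fun p => t * p.2) fun p q h1 h2 =>
        Prod.ext (mul_left_cancel₀ (by omega) h1) (mul_left_cancel₀ (by omega) h2)
    · exact exists_lexMax hne (fun p => t * p.2) (fun p => s * p.1) fun p q h1 h2 =>
        Prod.ext (mul_left_cancel₀ (by omega) h2) (mul_left_cancel₀ (by omega) h1)
  obtain ⟨⟨rt, hrt, hrtm⟩, ⟨tr, htr, htrm⟩⟩ := lex 1 1 rfl rfl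
  obtain ⟨⟨rb, hrb, hrbm⟩, ⟨br, hbr, hbrm⟩⟩ := lex 1 (-1) rfl rfl
  obtain ⟨⟨lb, hlb, hlbm⟩, ⟨bl, hbl, hblm⟩⟩ := lex (-1) (-1) rfl rfl
  obtain ⟨⟨lt, hlt, hltm⟩, ⟨tl, htl, htlm⟩⟩ := lex (-1) 1 rfl rfl
  clear lex
  have hRm : n < rt.1 := by
    rcases eq_or_ne pR rt with rfl | h
    · exact hpR'
    · have := hrtm pR hpR h; omega
  have hRm' : n < rb.1 := by
    rcases eq_or_ne pR rb with rfl | h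
    · exact hpR'
    · have := hrbm pR hpR h; omega
  have hLm : lb.1 < 0 := by
    rcases eq_or_ne pL lb with rfl | h
    · exact hpL'
    · have := hlbm pL hpL h; omega
  have hLm' : lt.1 < 0 := by
    rcases eq_or_ne pL lt with rfl | h
    · exact hpL'
    · have := hltm pL hpL h; omega
  have hTm : n < tr.2 := by
    rcases eq_or_ne pT tr with rfl | h
    · exact hpT'
    · have := htrm pT hpT h; omega
  have hTm' : n < tl.2 := by
    rcases eq_or_ne pT tl with rfl | h
    · exact hpT'
    · have := htlm pT hpT h; omega
  have hBm : br.2 < 0 := by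
    rcases eq_or_ne pB br with rfl | h
    · exact hpB'
    · have := hbrm pB hpB h; omega
  have hBm' : bl.2 < 0 := by
    rcases eq_or_ne pB bl with rfl | h
    · exact hpB'
    · have := hblm pB hpB h; omega
  obtain ⟨h11, h12, h13, h14⟩ := two_mul_card_quadrantChain_le V 1 1 rfl rfl (n, n) tr rt k
    (fun p => p.1 - n) (fun p => p.2 - n) (fun p => by ring) (fun p => by ring)
    (fun p hp q hq h1 h2 => by
      have := (hxn p hp q hq (by omega) (by omega) (by omega)).2
      linarith)
    (fun p hp q hq h1 h2 => by
      have := (hyn p hp q hq (by omega) (by omega) (by omega)).2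
      linarith)
    ⟨pL, hpL, by omega⟩ htr (fun q hq h => by have := htrm q hq h; omega) (by omega)
    hrt (fun q hq h => by have := hrtm q hq h; omega) (by omega) hk
    (fun p hp q hq h => hdet p hp q hq n n (Or.inr rfl) (Or.inr rfl) h)
  obtain ⟨h21, h22, h23, h24⟩ := two_mul_card_quadrantChain_le V 1 (-1) rfl rfl (n, 0) br rb k
    (fun p => p.1 - n) (fun p => -p.2) (fun p => by ring) (fun p => by ring)
    (fun p hp q hq h1 h2 => by
      have := (hxn p hp q hq (by omega) (by omega) (by omega)).1
      linarith)
    (fun p hp q hq h1 h2 => by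
      have := (hy0 q hq p hp (by omega) (by omega) (by omega)).2
      linarith)
    ⟨pL, hpL, by omega⟩ hbr (fun q hq h => by have := hbrm q hq h; omega) (by omega)
    hrb (fun q hq h => by have := hrbm q hq h; omega) (by omega) hk
    (fun p hp q hq h => hdet p hp q hq n 0 (Or.inr rfl) (Or.inl rfl) (by
      rw [← h, ← Int.natAbs_neg]; congr 1; ring))
  obtain ⟨h31, h32, h33, h34⟩ := two_mul_card_quadrantChain_le V (-1) (-1) rfl rfl (0, 0) bl lb k
    (fun p => -p.1) (fun p => -p.2) (fun p => by ring) (fun p => by ring)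
    (fun p hp q hq h1 h2 => by
      have := (hx0 q hq p hp (by omega) (by omega) (by omega)).1
      linarith)
    (fun p hp q hq h1 h2 => by
      have := (hy0 q hq p hp (by omega) (by omega) (by omega)).1
      linarith)
    ⟨pR, hpR, by omega⟩ hbl (fun q hq h => by have := hblm q hq h; omega) (by omega)
    hlb (fun q hq h => by have := hlbm q hq h; omega) (by omega) hk
    (fun p hp q hq h => hdet p hp q hq 0 0 (Or.inl rfl) (Or.inl rfl) (by
      rw [← h]; congr 1; ring))
  obtain ⟨h41, h42, h43, h44⟩ := two_mul_card_quadrantChain_le V (-1) 1 rfl rfl (0, n) tl lt k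
    (fun p => -p.1) (fun p => p.2 - n) (fun p => by ring) (fun p => by ring)
    (fun p hp q hq h1 h2 => by
      have := (hx0 q hq p hp (by omega) (by omega) (by omega)).2
      linarith)
    (fun p hp q hq h1 h2 => by
      have := (hyn p hp q hq (by omega) (by omega) (by omega)).1
      linarith)
    ⟨pR, hpR, by omega⟩ htl (fun q hq h => by have := htlm q hq h; omega) (by omega)
    hlt (fun q hq h => by have := hltm q hq h; omega) (by omega) hk
    (fun p hp q hq h => hdet p hp q hq 0 n (Or.inl rfl) (Or.inr rfl) (by
      rw [← h, ← Int.natAbs_neg]; congr 1; ring))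
  have hcard := card_le_of_cyclic_cover (fun p hp => hV.mem_quadrantChain hp)
    h12 h22 h23.symm h21 h31 h33 h32 h42 h43.symm h41 h11 h13
  -- A genuine side costs 2 and has length at least `κ`; a degenerate one costs nothing, and `κ ≤ 2`
  -- suffices.
  have x1 : 2 * ((if rt = rb then 0 else 1 : ℕ) : ℤ) ≤ rt.2 - rb.2 + 2 - κ := by
    split_ifs with h
    · rw [h]; omega
    · have i1 := hrtm rb hrb (Ne.symm h)
      have i2 := hrbm rt hrt h
      have := hver rb hrb rt hrt (by omega) (by omega)
      push_cast; omega
  have x2 : 2 * ((if br = bl then 0 else 1 : ℕ) : ℤ) ≤ br.1 - bl.1 + 2 - κ := by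
    split_ifs with h
    · rw [h]; omega
    · have i1 := hbrm bl hbl (Ne.symm h)
      have i2 := hblm br hbr h
      have := hhor bl hbl br hbr (by omega) (by omega)
      push_cast; omega
  have x3 : 2 * ((if lb = lt then 0 else 1 : ℕ) : ℤ) ≤ lt.2 - lb.2 + 2 - κ := by
    split_ifs with h
    · rw [h]; omega
    · have i1 := hlbm lt hlt (Ne.symm h)
      have i2 := hltm lb hlb h
      have := hver lb hlb lt hlt (by omega) (by omega)
      push_cast; omega
  have x4 : 2 * ((if tl = tr then 0 else 1 : ℕ) : ℤ) ≤ tr.1 - tl.1 + 2 - κ := by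
    split_ifs with h
    · rw [h]; omega
    · have i1 := htlm tr htr (Ne.symm h)
      have i2 := htrm tl htl h
      have := hhor tl htl tr htr (by omega) (by omega)
      push_cast; omega
  omega

/-! ### From the real polygon to its integer vertices -/

/-- The inclusion of the integer points into the plane. -/
def toPlane (p : ℤ × ℤ) : ℝ × ℝ := ((p.1 : ℝ), (p.2 : ℝ))

theorem toPlane_injective : Function.Injective toPlane := by
  intro p q h
  simp only [toPlane, Prod.mk.injEq, Int.cast_inj] at h
  exact Prod.ext h.1 h.2

open Filter Topology in
/-- A strict maximum of a linear form on a finite set is the strict maximum of a linear form with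
nonzero coefficients. -/
theorem exists_ne_zero_coeffs {ι : Type*} (V : Finset ι) (a : ι) (f g : ι → ℝ) (α β : ℝ)
    (h : ∀ q ∈ V, q ≠ a → α * (f q - f a) + β * (g q - g a) < 0) :
    ∃ α' β' : ℝ, α' ≠ 0 ∧ β' ≠ 0 ∧
      ∀ q ∈ V, q ≠ a → α' * (f q - f a) + β' * (g q - g a) < 0 := by
  have hne : ∀ c : ℝ, ∀ᶠ ε : ℝ in 𝓝[>] 0, c + ε ≠ 0 := by
    intro c
    rcases eq_or_ne c 0 with rfl | hc
    · filter_upwards [self_mem_nhdsWithin] with ε hε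
      rw [zero_add]
      exact ne_of_gt hε
    · have ht : Tendsto (fun ε : ℝ => c + ε) (𝓝 0) (𝓝 (c + 0)) :=
        Continuous.tendsto (by fun_prop) 0
      exact (ht.mono_left nhdsWithin_le_nhds).eventually_ne (by simpa using hc)
  have hev : ∀ᶠ ε : ℝ in 𝓝[>] 0, ∀ q ∈ V, q ≠ a →
      (α + ε) * (f q - f a) + (β + ε) * (g q - g a) < 0 := by
    rw [Filter.eventually_all_finset]
    intro q hq
    rcases eq_or_ne q a with rfl | hqa
    · simp
    · have hc : Tendsto (fun ε : ℝ => (α + ε) * (f q - f a) + (β + ε) * (g q - g a)) (𝓝 0)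
          (𝓝 ((α + 0) * (f q - f a) + (β + 0) * (g q - g a))) :=
        Continuous.tendsto (by fun_prop) 0
      filter_upwards [(hc.mono_left nhdsWithin_le_nhds).eventually_lt_const
        (show (α + 0) * (f q - f a) + (β + 0) * (g q - g a) < 0 by
          simpa using h q hq hqa)] with ε hε _ using hε
  obtain ⟨ε, ⟨h1, h2⟩, h3⟩ := (((hne α).and (hne β)).and hev).exists
  exact ⟨α + ε, β + ε, h1, h2, h3⟩

/-- The integer vertices of a convex integer polygon. -/
theorem IsConvexIntegerGon.exists_vertices {N : ℕ} {P : Set (ℝ × ℝ)}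
    (h : IsConvexIntegerGon N P) :
    ∃ V : Finset (ℤ × ℤ), V.card = N ∧ polygonVertices P = toPlane '' V ∧
      P = convexHull ℝ (toPlane '' V) ∧ StrictlyExposed V := by
  obtain ⟨⟨⟨s, hs⟩, -⟩, hint, hcard⟩ := h
  have hconv : Convex ℝ P := hs ▸ convex_convexHull ℝ _
  have hcomp : IsCompact P := hs ▸ s.finite_toSet.isCompact_convexHull ℝ
  have hfin : (polygonVertices P).Finite := by
    rw [polygonVertices, hs]
    exact s.finite_toSet.subset extremePoints_convexHull_subset
  set V := (hfin.preimage toPlane_injective.injOn).toFinset with hVdef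
  have hVimg : polygonVertices P = toPlane '' V := by
    rw [hVdef, Set.Finite.coe_toFinset, Set.image_preimage_eq_of_subset]
    intro x hx
    obtain ⟨u, v, rfl⟩ := hint hx
    exact ⟨(u, v), rfl⟩
  -- Krein–Milman; the closure is superfluous because there are finitely many vertices.
  have hP : P = convexHull ℝ (toPlane '' V) := by
    have h1 : closure (convexHull ℝ (polygonVertices P)) = P :=
      closure_convexHull_extremePoints hcomp hconv
    rw [← hVimg]
    rw [(hfin.isClosed_convexHull ℝ).closure_eq] at h1
    exact h1.symm
  refine ⟨V, ?_, hVimg, hP, ?_⟩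
  · rw [← hcard, hVimg, Set.ncard_image_of_injective _ toPlane_injective, Set.ncard_coe_finset]
  · intro p hp
    have hx : toPlane p ∈ P.extremePoints ℝ := by
      change toPlane p ∈ polygonVertices P
      rw [hVimg]
      exact Set.mem_image_of_mem _ hp
    have hx' := (hconv.mem_extremePoints_iff_mem_sdiff_convexHull_sdiff.1 hx).2
    set W := toPlane '' ((V : Set (ℤ × ℤ)) \ {p}) with hW
    have hWfin : W.Finite := (V.finite_toSet.subset Set.sdiff_subset).image _
    have hWP : W ⊆ P \ {toPlane p} := by
      rintro _ ⟨q, ⟨hq, hqp⟩, rfl⟩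
      refine ⟨?_, fun h => hqp (toPlane_injective h)⟩
      rw [hP]
      exact subset_convexHull ℝ _ (Set.mem_image_of_mem _ hq)
    -- A vertex is not in the hull of the others, so Hahn–Banach separates it; `-f` is then strictly
    -- maximal there.
    obtain ⟨f, u, hfu, hfW⟩ := geometric_hahn_banach_point_closed (convex_convexHull ℝ W)
      (hWfin.isClosed_convexHull ℝ) fun hmem => hx' (convexHull_mono hWP hmem)
    have hf : ∀ x : ℝ × ℝ, f x = x.1 * f (1, 0) + x.2 * f (0, 1) := by
      intro x
      rw [← smul_eq_mul, ← smul_eq_mul, ← map_smul, ← map_smul, ← map_add]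
      simp
    refine exists_ne_zero_coeffs V p (fun q => (q.1 : ℝ)) (fun q => (q.2 : ℝ))
      (-f (1, 0)) (-f (0, 1)) fun q hq hne => ?_
    have h1 := hfW (toPlane q) (subset_convexHull ℝ _ ⟨q, ⟨hq, hne⟩, rfl⟩)
    rw [hf] at h1 hfu
    simp only [toPlane] at h1 hfu
    linarith

theorem exists_lt_of_mem_convexHull {V : Finset (ℤ × ℤ)} {x : ℝ × ℝ}
    (hx : x ∈ convexHull ℝ (toPlane '' V)) (l : ℝ × ℝ →ₗ[ℝ] ℝ) (c : ℝ) (hc : c < l x) :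
    ∃ p ∈ V, c < l (toPlane p) := by
  by_contra! hcon
  have : convexHull ℝ (toPlane '' V) ⊆ {y | l y ≤ c} :=
    convexHull_min (by rintro _ ⟨p, hp, rfl⟩; exact hcon p hp) (convex_halfSpace_le l.isLinear c)
  exact absurd (this hx) (not_le.2 hc)

/-- The convex combination of `p` and `q` with abscissa `c` lies in `P`; its height bounds are
multiplied by `q.1 - p.1`. -/
theorem crossing_of_convex {P : Set (ℝ × ℝ)} (hP : Convex ℝ P) (c n : ℤ)
    (h : ∀ y : ℝ, ((c : ℝ), y) ∈ P → 0 < y ∧ y < n) {p q : ℤ × ℤ} (hp : toPlane p ∈ P)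
    (hq : toPlane q ∈ P) (hpc : p.1 ≤ c) (hcq : c ≤ q.1) (hpq : p.1 < q.1) :
    0 < p.2 * (q.1 - c) - (p.1 - c) * q.2 ∧
      p.2 * (q.1 - c) - (p.1 - c) * q.2 < n * (q.1 - p.1) := by
  have h1 : (p.1 : ℝ) ≤ c := by exact_mod_cast hpc
  have h2 : (c : ℝ) ≤ q.1 := by exact_mod_cast hcq
  have h3 : (0 : ℝ) < q.1 - p.1 := sub_pos.2 (by exact_mod_cast hpq)
  have hmem := hP hp hq (a := (q.1 - c) / (q.1 - p.1)) (b := (c - p.1) / (q.1 - p.1))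
    (div_nonneg (by linarith) h3.le) (div_nonneg (by linarith) h3.le) (by field_simp; ring)
  have heq : ((q.1 - c) / (q.1 - p.1) : ℝ) • toPlane p + ((c - p.1) / (q.1 - p.1) : ℝ) • toPlane q
      = ((c : ℝ), ((p.2 * (q.1 - c) - (p.1 - c) * q.2) / (q.1 - p.1) : ℝ)) := by
    simp only [toPlane, Prod.smul_mk, Prod.mk_add_mk, smul_eq_mul, Prod.mk.injEq]
    constructor <;> field_simp <;> ring
  rw [heq] at hmem
  obtain ⟨h4, h5⟩ := h _ hmem
  rw [lt_div_iff₀ h3, zero_mul] at h4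
  rw [div_lt_iff₀ h3] at h5
  exact ⟨by exact_mod_cast h4, by exact_mod_cast h5⟩

theorem crossing_of_convex' {P : Set (ℝ × ℝ)} (hP : Convex ℝ P) (c n : ℤ)
    (h : ∀ x : ℝ, (x, (c : ℝ)) ∈ P → 0 < x ∧ x < n) {p q : ℤ × ℤ} (hp : toPlane p ∈ P)
    (hq : toPlane q ∈ P) (hpc : p.2 ≤ c) (hcq : c ≤ q.2) (hpq : p.2 < q.2) :
    0 < p.1 * (q.2 - c) - (p.2 - c) * q.1 ∧
      p.1 * (q.2 - c) - (p.2 - c) * q.1 < n * (q.2 - p.2) :=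
  crossing_of_convex (P := Prod.swap ⁻¹' P)
    (hP.is_linear_preimage (f := Prod.swap) ⟨fun _ _ => rfl, fun _ _ => rfl⟩) c n h
    (p := p.swap) (q := q.swap) hp hq hpc hcq hpq

/-- Each cut lies in a closed side whose endpoints belong to `nℤ²`, so it avoids them. A point of
`P` beyond a side forces a vertex beyond it; the sign of `lineSide` there depends on the orientation
of the segment. -/
theorem IsTypeII.splitBySquare {n : ℕ} {P : Set (ℝ × ℝ)} (h : IsTypeII n P) {V : Finset (ℤ × ℤ)}
    (hV : P = convexHull ℝ (toPlane '' V)) : SplitBySquare V n := by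
  obtain ⟨hdis, ⟨hb, -, hb'⟩, ⟨hr, -, hr'⟩, ⟨ht, ht', -⟩, ⟨hl, hl', -⟩⟩ := h
  have hconv : Convex ℝ P := hV ▸ convex_convexHull ℝ _
  have hVP : ∀ p ∈ V, toPlane p ∈ P := fun p hp =>
    hV ▸ subset_convexHull ℝ _ (Set.mem_image_of_mem _ hp)
  have hlat : ∀ u v : ℤ, ((n : ℝ) * u, (n : ℝ) * v) ∉ P := fun u v hmem =>
    Set.disjoint_left.1 hdis hmem ⟨u, v, rfl⟩
  have h00 := hlat 0 0
  have h01 := hlat 0 1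
  have h10 := hlat 1 0
  have h11 := hlat 1 1
  simp only [Int.cast_zero, Int.cast_one, mul_zero, mul_one] at h00 h01 h10 h11
  have strict : ∀ y : ℝ, 0 ≤ y → y ≤ n → y ≠ 0 → y ≠ n → 0 < y ∧ y < n := fun y h1 h2 h3 h4 =>
    ⟨lt_of_le_of_ne h1 (Ne.symm h3), lt_of_le_of_ne h2 h4⟩
  have scaled : ∀ a b : ℝ, 0 ≤ a → 0 ≤ b → a + b = 1 → 0 ≤ b * n ∧ b * n ≤ n := by
    intro a b ha hb hab
    exact ⟨by positivity, mul_le_of_le_one_left (by positivity) (by linarith)⟩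
  have hx0 : ∀ y : ℝ, (((0 : ℤ) : ℝ), y) ∈ P → 0 < y ∧ y < (n : ℤ) := by
    intro y hy
    rw [Int.cast_zero] at hy
    obtain ⟨a, b, ha, hb, hab, heq⟩ := hl ⟨hy, by simp [lineSide]⟩
    simp only [Prod.smul_mk, Prod.mk_add_mk, Prod.mk.injEq, smul_eq_mul, mul_zero, zero_add] at heq
    obtain ⟨h1, h2⟩ := scaled a b ha hb hab
    rw [heq.2] at h1 h2
    exact strict y h1 h2 (by rintro rfl; exact h00 hy) (by rintro rfl; exact h01 hy)
  have hxn : ∀ y : ℝ, (((n : ℤ) : ℝ), y) ∈ P → 0 < y ∧ y < (n : ℤ) := by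
    intro y hy
    rw [Int.cast_natCast] at hy
    obtain ⟨a, b, ha, hb, hab, heq⟩ := hr ⟨hy, by simp [lineSide]⟩
    simp only [Prod.smul_mk, Prod.mk_add_mk, Prod.mk.injEq, smul_eq_mul, mul_zero, zero_add] at heq
    obtain ⟨h1, h2⟩ := scaled a b ha hb hab
    rw [heq.2] at h1 h2
    exact strict y h1 h2 (by rintro rfl; exact h10 hy) (by rintro rfl; exact h11 hy)
  have hy0 : ∀ x : ℝ, (x, ((0 : ℤ) : ℝ)) ∈ P → 0 < x ∧ x < (n : ℤ) := by
    intro x hx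
    rw [Int.cast_zero] at hx
    obtain ⟨a, b, ha, hb, hab, heq⟩ := hb ⟨hx, by simp [lineSide]⟩
    simp only [Prod.smul_mk, Prod.mk_add_mk, Prod.mk.injEq, smul_eq_mul, mul_zero, zero_add] at heq
    obtain ⟨h1, h2⟩ := scaled a b ha hb hab
    rw [heq.1] at h1 h2
    exact strict x h1 h2 (by rintro rfl; exact h00 hx) (by rintro rfl; exact h10 hx)
  have hyn : ∀ x : ℝ, (x, ((n : ℤ) : ℝ)) ∈ P → 0 < x ∧ x < (n : ℤ) := by
    intro x hx
    rw [Int.cast_natCast] at hx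
    obtain ⟨a, b, ha, hb, hab, heq⟩ := ht ⟨hx, by simp [lineSide]⟩
    simp only [Prod.smul_mk, Prod.mk_add_mk, Prod.mk.injEq, smul_eq_mul, mul_zero, zero_add] at heq
    obtain ⟨h1, h2⟩ := scaled a b ha hb hab
    rw [heq.1] at h1 h2
    exact strict x h1 h2 (by rintro rfl; exact h01 hx) (by rintro rfl; exact h11 hx)
  have hn0 : (0 : ℝ) ≤ n := n.cast_nonneg
  refine ⟨fun p hp q hq => crossing_of_convex hconv 0 n hx0 (hVP p hp) (hVP q hq),
    fun p hp q hq => crossing_of_convex hconv n n hxn (hVP p hp) (hVP q hq),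
    fun p hp q hq => crossing_of_convex' hconv 0 n hy0 (hVP p hp) (hVP q hq),
    fun p hp q hq => crossing_of_convex' hconv n n hyn (hVP p hp) (hVP q hq), ?_, ?_, ?_, ?_⟩
  · obtain ⟨x, hx⟩ := hr'
    obtain ⟨hxP, hx⟩ := interior_subset hx
    have hx1 : (n : ℝ) < x.1 := by
      simp only [lineSide, Set.mem_ofPred_eq] at hx
      nlinarith
    obtain ⟨p, hp, h⟩ := exists_lt_of_mem_convexHull (hV ▸ hxP) (LinearMap.fst ℝ ℝ ℝ) n hx1
    have h' : (n : ℝ) < p.1 := h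
    exact ⟨p, hp, by exact_mod_cast h'⟩
  · obtain ⟨x, hx⟩ := hl'
    obtain ⟨hxP, hx⟩ := interior_subset hx
    have hx1 : 0 < -x.1 := by
      simp only [lineSide, Set.mem_ofPred_eq] at hx
      nlinarith
    obtain ⟨p, hp, h⟩ := exists_lt_of_mem_convexHull (hV ▸ hxP) (-LinearMap.fst ℝ ℝ ℝ) 0 hx1
    have h' : (p.1 : ℝ) < 0 := neg_pos.1 h
    exact ⟨p, hp, by exact_mod_cast h'⟩
  · obtain ⟨x, hx⟩ := ht'
    obtain ⟨hxP, hx⟩ := interior_subset hx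
    have hx1 : (n : ℝ) < x.2 := by
      simp only [lineSide, Set.mem_ofPred_eq] at hx
      nlinarith
    obtain ⟨p, hp, h⟩ := exists_lt_of_mem_convexHull (hV ▸ hxP) (LinearMap.snd ℝ ℝ ℝ) n hx1
    have h' : (n : ℝ) < p.2 := h
    exact ⟨p, hp, by exact_mod_cast h'⟩
  · obtain ⟨x, hx⟩ := hb'
    obtain ⟨hxP, hx⟩ := interior_subset hx
    have hx1 : 0 < -x.2 := by
      simp only [lineSide, Set.mem_ofPred_eq] at hx
      nlinarith
    obtain ⟨p, hp, h⟩ := exists_lt_of_mem_convexHull (hV ▸ hxP) (-LinearMap.snd ℝ ℝ ℝ) 0 hx1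
    have h' : (p.2 : ℝ) < 0 := neg_pos.1 h
    exact ⟨p, hp, by exact_mod_cast h'⟩

/-! ### Type I: counting by columns -/

theorem StrictlyExposed.swap {V : Finset (ℤ × ℤ)} (hV : StrictlyExposed V) :
    StrictlyExposed (V.image Prod.swap) := by
  simp only [StrictlyExposed, Finset.forall_mem_image, Prod.fst_swap, Prod.snd_swap]
  intro p hp
  obtain ⟨α, β, hα, hβ, h⟩ := hV p hp
  exact ⟨β, α, hβ, hα, fun q hq hne => by linarith [h q hq fun h' => hne (by rw [h'])]⟩

/-- A linear form is monotone along a vertical line, so it has no strict maximum at a middle point.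
-/
theorem StrictlyExposed.not_between {V : Finset (ℤ × ℤ)} (hV : StrictlyExposed V) {p q r : ℤ × ℤ}
    (hp : p ∈ V) (hq : q ∈ V) (hr : r ∈ V) (hpq : p.1 = q.1) (hqr : q.1 = r.1) (h1 : p.2 < q.2)
    (h2 : q.2 < r.2) : False := by
  obtain ⟨α, β, -, -, h⟩ := hV q hq
  have h3 := h p hp (by rintro rfl; omega)
  have h4 := h r hr (by rintro rfl; omega)
  rw [hpq, sub_self, mul_zero, zero_add] at h3
  rw [← hqr, sub_self, mul_zero, zero_add] at h4
  have h5 : (p.2 : ℝ) < q.2 := by exact_mod_cast h1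
  have h6 : (q.2 : ℝ) < r.2 := by exact_mod_cast h2
  have h7 := pos_of_mul_neg_left h3 (by linarith)
  nlinarith

/-- Every column contains at most two strictly exposed points. -/
theorem StrictlyExposed.card_le {V : Finset (ℤ × ℤ)} (hV : StrictlyExposed V)
    {W : Finset (ℤ × ℤ)} (hW : W ⊆ V) : W.card ≤ 2 * (W.image Prod.fst).card := by
  refine Finset.card_le_mul_card_image W 2 fun x _ => ?_
  by_contra hcon
  obtain ⟨a, b, c, ha, hb, hc, hab, hac, hbc⟩ := Finset.two_lt_card_iff.1 (not_le.1 hcon)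
  obtain ⟨ha, ha1⟩ := Finset.mem_filter.1 ha
  obtain ⟨hb, hb1⟩ := Finset.mem_filter.1 hb
  obtain ⟨hc, hc1⟩ := Finset.mem_filter.1 hc
  have hne : ∀ p q : ℤ × ℤ, p.1 = x → q.1 = x → p ≠ q → p.2 ≠ q.2 := fun p q h1 h2 h3 h4 =>
    h3 (Prod.ext (h1.trans h2.symm) h4)
  have hord : ∀ p ∈ W, ∀ q ∈ W, ∀ r ∈ W, p.1 = x → q.1 = x → r.1 = x → p.2 < q.2 → ¬ q.2 < r.2 :=
    fun p hp q hq r hr h1 h2 h3 h4 h5 => hV.not_between (hW hp) (hW hq) (hW hr)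
      (h1.trans h2.symm) (h2.trans h3.symm) h4 h5
  have n1 := hne a b ha1 hb1 hab
  have n2 := hne a c ha1 hc1 hac
  have n3 := hne b c hb1 hc1 hbc
  have o1 := hord a ha b hb c hc ha1 hb1 hc1
  have o2 := hord a ha c hc b hb ha1 hc1 hb1
  have o3 := hord b hb a ha c hc hb1 ha1 hc1
  have o4 := hord b hb c hc a ha hb1 hc1 ha1
  have o5 := hord c hc a ha b hb hc1 ha1 hb1
  have o6 := hord c hc b hb a ha hc1 hb1 ha1
  omega

theorem StrictlyExposed.card_le_of_Icc {V : Finset (ℤ × ℤ)} (hV : StrictlyExposed V)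
    {W : Finset (ℤ × ℤ)} (hW : W ⊆ V) (a b : ℤ) (h : ∀ p ∈ W, a ≤ p.1 ∧ p.1 ≤ b) :
    W.card ≤ 2 * (b + 1 - a).toNat := by
  refine (hV.card_le hW).trans (Nat.mul_le_mul_left 2 ?_)
  rw [← Int.card_Icc]
  refine Finset.card_le_card fun x hx => ?_
  obtain ⟨p, hp, rfl⟩ := Finset.mem_image.1 hx
  exact Finset.mem_Icc.2 (h p hp)

/-- The bounds for the number of vertices of a polygon in a slab of width `n` whose vertices lie in
a lattice of index `m`, a divisor of `n`. -/
theorem StrictlyExposed.card_le_of_slab {V : Finset (ℤ × ℤ)} (hV : StrictlyExposed V) (n : ℕ)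
    (hn : 3 ≤ n) (j : ℤ) (hslab : ∀ p ∈ V, j * n ≤ p.1 ∧ p.1 ≤ (j + 1) * n) (m : ℕ)
    (hm : n = m ∨ n = 2 * m)
    (hfree : ∀ p ∈ V, ∀ q ∈ V, p.1 = q.1 → (n : ℤ) ∣ p.1 → ∀ w : ℤ, p.2 ≤ n * w → ¬ n * w ≤ q.2)
    (hlat : (∃ g : ℤ, 2 ≤ g ∧ ∀ p ∈ V, g ∣ p.1) ∨ ∀ p ∈ V, (n : ℤ) ∣ p.1 → (m : ℤ) ∣ p.2) :
    V.card ≤ 2 * n ∧ (n = m → V.card ≤ 2 * n - 2) := by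
  have hw : (j + 1) * (n : ℤ) = j * n + n := by ring
  rcases hlat with ⟨g, hg, hgV⟩ | hlat
  -- Occupied columns are 2-separated, so there are at most `n / 2 + 1`, rounded down; the rounding
  -- matters for `n = 3`.
  · have h1 := two_mul_card_le_of_separated (V.image Prod.fst) id (j * n) ((j + 1) * n)
      (by simp only [Finset.forall_mem_image]; exact fun p hp => (hslab p hp).1)
      (by simp only [Finset.forall_mem_image]; exact fun p hp => (hslab p hp).2) (by omega) (by
        simp only [Finset.forall_mem_image, id]
        intro p hp q hq hne
        obtain ⟨a, ha⟩ := hgV p hp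
        obtain ⟨b, hb⟩ := hgV q hq
        rw [ha, hb] at hne ⊢
        rcases lt_trichotomy a b with h | h | h
        · left; nlinarith
        · exact absurd (by rw [h]) hne
        · right; nlinarith)
    have h2 := hV.card_le subset_rfl
    constructor
    · omega
    · intro _; omega
  · have hn0 : ∀ p ∈ V, (n : ℤ) ∣ p.1 → ¬ (n : ℤ) ∣ p.2 := by
      rintro p hp h1 ⟨w, hw⟩
      exact hfree p hp p hp rfl h1 w hw.le hw.ge
    set I := V.filter fun p => j * n < p.1 ∧ p.1 < (j + 1) * n with hI
    have hIcard := hV.card_le_of_Icc (Finset.filter_subset _ V : I ⊆ V) (j * n + 1)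
      ((j + 1) * n - 1) fun p hp => by
        have := (Finset.mem_filter.1 hp).2
        omega
    have hIcard' : I.card ≤ 2 * (n - 1) := by
      refine hIcard.trans (Nat.mul_le_mul_left 2 ?_)
      omega
    rcases hm with rfl | hm
    · have hVI : V ⊆ I := by
        intro p hp
        refine Finset.mem_filter.2 ⟨hp, lt_of_le_of_ne (hslab p hp).1 fun h => ?_,
          lt_of_le_of_ne (hslab p hp).2 fun h => ?_⟩
        · have hd : (n : ℤ) ∣ p.1 := h ▸ Dvd.intro_left j rfl
          exact hn0 p hp hd (hlat p hp hd)
        · have hd : (n : ℤ) ∣ p.1 := h ▸ Dvd.intro_left (j + 1) rfl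
          exact hn0 p hp hd (hlat p hp hd)
      have := Finset.card_le_card hVI
      constructor
      · omega
      · intro _; omega
    · refine ⟨?_, fun h => by omega⟩
      have hmn : (n : ℤ) = 2 * m := by exact_mod_cast hm
      have hm0 : (0 : ℤ) < m := by omega
      -- On a boundary column the heights are odd multiples of `m = n / 2`, and two distinct ones
      -- enclose a multiple of `n`.
      have hcol : ∀ p ∈ V, ∀ q ∈ V, p.1 = q.1 → (n : ℤ) ∣ p.1 → ¬ p.2 < q.2 := by
        intro p hp q hq hpq hd hlt
        obtain ⟨a, ha⟩ := hlat p hp hd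
        obtain ⟨b, hb⟩ := hlat q hq (hpq ▸ hd)
        have hab : a < b := by
          rw [ha, hb] at hlt
          exact lt_of_mul_lt_mul_left hlt hm0.le
        rcases Int.even_or_odd' a with ⟨w, hw | hw⟩
        · exact hn0 p hp hd ⟨w, by rw [ha, hw, hmn]; ring⟩
        · refine hfree p hp q hq hpq hd (w + 1) ?_ ?_
          · rw [ha, hw, hmn]; nlinarith
          · rw [hb, hmn]; nlinarith
      have hone : ∀ i : ℤ, (V.filter fun p => p.1 = i * n).card ≤ 1 := by
        intro i
        rw [Finset.card_le_one]
        intro p hp q hq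
        obtain ⟨hp, hp1⟩ := Finset.mem_filter.1 hp
        obtain ⟨hq, hq1⟩ := Finset.mem_filter.1 hq
        have h1 := hcol p hp q hq (by omega) (hp1 ▸ Dvd.intro_left i rfl)
        have h2 := hcol q hq p hp (by omega) (hq1 ▸ Dvd.intro_left i rfl)
        exact Prod.ext (by omega) (by omega)
      have hcover : V ⊆ (I ∪ V.filter fun p => p.1 = j * n) ∪
          V.filter fun p => p.1 = (j + 1) * n := by
        intro p hp
        have := hslab p hp
        simp only [hI, Finset.mem_union, Finset.mem_filter, hp, true_and]
        omega
      have h1 := Finset.card_le_card hcover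
      have h2 := Finset.card_union_le (I ∪ V.filter fun p => p.1 = j * n)
        (V.filter fun p => p.1 = (j + 1) * n)
      have h3 := Finset.card_union_le I (V.filter fun p => p.1 = j * n)
      have h4 := hone j
      have h5 := hone (j + 1)
      omega

/-! ### Arithmetic of the lattice -/

/-- Vertices in a lattice of index `m`: all determinants are divisible by `m`, and each coordinate
either has a common divisor or determines the other one modulo `m`. -/
theorem IsInvariantFactorLattice.properties {m : ℕ} {Γ : Set (ℝ × ℝ)}
    (h : IsInvariantFactorLattice 1 m Γ) {V : Finset (ℤ × ℤ)} (hV : toPlane '' V ⊆ Γ) (n : ℤ)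
    (hmn : (m : ℤ) ∣ n) :
    (∀ p ∈ V, ∀ q ∈ V, (m : ℤ) ∣ p.1 * q.2 - p.2 * q.1) ∧
    ((∃ g : ℤ, 2 ≤ g ∧ ∀ p ∈ V, g ∣ p.1) ∨ ∀ p ∈ V, n ∣ p.1 → (m : ℤ) ∣ p.2) ∧
    ((∃ g : ℤ, 2 ≤ g ∧ ∀ p ∈ V, g ∣ p.2) ∨ ∀ p ∈ V, n ∣ p.2 → (m : ℤ) ∣ p.1) := by
  obtain ⟨A, hA, rfl, -, hdet⟩ := h
  rw [one_mul] at hdet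
  have hm : (m : ℤ) ∣ A.det := Int.natCast_dvd.2 (dvd_of_eq hdet.symm)
  rw [Matrix.det_fin_two] at hA hm
  have hmem : ∀ p ∈ V, ∃ u v : ℤ, p.1 = A 0 0 * u + A 0 1 * v ∧ p.2 = A 1 0 * u + A 1 1 * v := by
    intro p hp
    obtain ⟨u, v, huv⟩ := hV (Set.mem_image_of_mem _ hp)
    simp only [toPlane, Prod.mk.injEq, Int.cast_inj] at huv
    exact ⟨u, v, huv⟩
  refine ⟨?_, ?_, ?_⟩
  · intro p hp q hq
    obtain ⟨u, v, h1, h2⟩ := hmem p hp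
    obtain ⟨u', v', h3, h4⟩ := hmem q hq
    refine hm.trans ⟨u * v' - v * u', ?_⟩
    rw [h1, h2, h3, h4]
    ring
  · rcases le_or_gt 2 (Int.gcd (A 0 0) (A 0 1)) with hg | hg
    · refine Or.inl ⟨Int.gcd (A 0 0) (A 0 1), by exact_mod_cast hg, fun p hp => ?_⟩
      obtain ⟨u, v, h1, -⟩ := hmem p hp
      rw [h1]
      exact dvd_add (Dvd.dvd.mul_right (Int.gcd_dvd_left ..) u)
        (Dvd.dvd.mul_right (Int.gcd_dvd_right ..) v)
    · have hg1 : Int.gcd (A 0 0) (A 0 1) = 1 := by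
        have : Int.gcd (A 0 0) (A 0 1) ≠ 0 := by
          intro h0
          obtain ⟨h1, h2⟩ := Int.gcd_eq_zero_iff.1 h0
          rw [h1, h2] at hA
          simp at hA
        omega
      have hbez := Int.gcd_eq_gcd_ab (A 0 0) (A 0 1)
      rw [hg1] at hbez
      set x := Int.gcdA (A 0 0) (A 0 1)
      set y := Int.gcdB (A 0 0) (A 0 1)
      right
      intro p hp hd
      obtain ⟨u, v, h1, h2⟩ := hmem p hp
      -- Bézout for the coprime first row makes `p.2` a fixed multiple of `p.1` modulo the
      -- determinant.
      have h3 : p.2 = (A 0 0 * A 1 1 - A 0 1 * A 1 0) * (x * v - y * u) +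
          (A 1 0 * x + A 1 1 * y) * p.1 := by
        have h4 : p.2 = p.2 * (A 0 0 * x + A 0 1 * y) := by rw [← hbez]; simp
        rw [h4, h1, h2]
        ring
      rw [h3]
      exact dvd_add (hm.mul_right _) ((hmn.trans hd).mul_left _)
  · rcases le_or_gt 2 (Int.gcd (A 1 0) (A 1 1)) with hg | hg
    · refine Or.inl ⟨Int.gcd (A 1 0) (A 1 1), by exact_mod_cast hg, fun p hp => ?_⟩
      obtain ⟨u, v, -, h1⟩ := hmem p hp
      rw [h1]
      exact dvd_add (Dvd.dvd.mul_right (Int.gcd_dvd_left ..) u)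
        (Dvd.dvd.mul_right (Int.gcd_dvd_right ..) v)
    · have hg1 : Int.gcd (A 1 0) (A 1 1) = 1 := by
        have : Int.gcd (A 1 0) (A 1 1) ≠ 0 := by
          intro h0
          obtain ⟨h1, h2⟩ := Int.gcd_eq_zero_iff.1 h0
          rw [h1, h2] at hA
          simp at hA
        omega
      have hbez := Int.gcd_eq_gcd_ab (A 1 0) (A 1 1)
      rw [hg1] at hbez
      set x := Int.gcdA (A 1 0) (A 1 1)
      set y := Int.gcdB (A 1 0) (A 1 1)
      right
      intro p hp hd
      obtain ⟨u, v, h2, h1⟩ := hmem p hp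
      have h3 : p.1 = -((A 0 0 * A 1 1 - A 0 1 * A 1 0) * (x * v - y * u)) +
          (A 0 0 * x + A 0 1 * y) * p.2 := by
        have h4 : p.1 = p.1 * (A 1 0 * x + A 1 1 * y) := by rw [← hbez]; simp
        rw [h4, h1, h2]
        ring
      rw [h3]
      exact dvd_add (hm.mul_right _).neg_right ((hmn.trans hd).mul_left _)

/-! ### The bounds for both types -/

/-- The three bounds for polygons of type I. -/
theorem IsTypeI.card_le {n : ℕ} (hn : 3 ≤ n) {P : Set (ℝ × ℝ)} (hT : IsTypeI n P)
    {V : Finset (ℤ × ℤ)} (hP : P = convexHull ℝ (toPlane '' V)) (hV : StrictlyExposed V) :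
    V.card ≤ 2 * n + 2 ∧
    ∀ (m : ℕ) (Γ : Set (ℝ × ℝ)), n = m ∨ n = 2 * m → IsInvariantFactorLattice 1 m Γ →
      toPlane '' V ⊆ Γ → V.card ≤ 2 * n ∧ (n = m → V.card ≤ 2 * n - 2) := by
  obtain ⟨hdis, j, hslab⟩ := hT
  have hVP : ∀ p ∈ V, toPlane p ∈ P := fun p hp =>
    hP ▸ subset_convexHull ℝ _ (Set.mem_image_of_mem _ hp)
  have hconv : Convex ℝ P := hP ▸ convex_convexHull ℝ _
  have hlat : ∀ u v : ℤ, ((n : ℝ) * u, (n : ℝ) * v) ∉ P := fun u v hmem =>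
    Set.disjoint_left.1 hdis hmem ⟨u, v, rfl⟩
  have hw : (j + 1) * (n : ℤ) = j * n + n := by ring
  have hdvd : ∀ m : ℕ, n = m ∨ n = 2 * m → (m : ℤ) ∣ n := by
    rintro m (rfl | rfl)
    · exact dvd_rfl
    · exact ⟨2, by push_cast; ring⟩
  rcases hslab with hslab | hslab
  · have hslab' : ∀ p ∈ V, j * n ≤ p.1 ∧ p.1 ≤ (j + 1) * n := by
      intro p hp
      obtain ⟨h1, h2⟩ := hslab _ (hVP p hp)
      simp only [toPlane] at h1 h2
      exact ⟨by exact_mod_cast h1, by exact_mod_cast h2⟩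
    refine ⟨(hV.card_le_of_Icc subset_rfl _ _ hslab').trans (by omega), ?_⟩
    intro m Γ hm hΓ hVΓ
    refine hV.card_le_of_slab n hn j hslab' m hm ?_ (hΓ.properties hVΓ n (hdvd m hm)).2.1
    rintro p hp q hq hpq ⟨i, hi⟩ w h1 h2
    refine hlat i w (hconv.segment_subset (hVP p hp) (hVP q hq) ?_)
    have e : (n : ℝ) * i = p.1 := by exact_mod_cast hi.symm
    have e1 : (p.2 : ℝ) ≤ n * w := by exact_mod_cast h1
    have e2 : (n : ℝ) * w ≤ q.2 := by exact_mod_cast h2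
    rw [toPlane, toPlane, e, ← hpq, ← Prod.image_mk_segment_right, segment_eq_Icc (e1.trans e2)]
    exact ⟨_, ⟨e1, e2⟩, rfl⟩
  · have hslab' : ∀ p ∈ V.image Prod.swap, j * n ≤ p.1 ∧ p.1 ≤ (j + 1) * n := by
      simp only [Finset.forall_mem_image, Prod.fst_swap]
      intro p hp
      obtain ⟨h1, h2⟩ := hslab _ (hVP p hp)
      simp only [toPlane] at h1 h2
      exact ⟨by exact_mod_cast h1, by exact_mod_cast h2⟩
    rw [← Finset.card_image_of_injective V Prod.swap_injective]
    refine ⟨(hV.swap.card_le_of_Icc subset_rfl _ _ hslab').trans (by omega), ?_⟩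
    intro m Γ hm hΓ hVΓ
    refine hV.swap.card_le_of_slab n hn j hslab' m hm ?_ ?_
    · simp only [Finset.forall_mem_image, Prod.fst_swap, Prod.snd_swap]
      rintro p hp q hq hpq ⟨i, hi⟩ w h1 h2
      refine hlat w i (hconv.segment_subset (hVP p hp) (hVP q hq) ?_)
      have e : (n : ℝ) * i = p.2 := by exact_mod_cast hi.symm
      have e1 : (p.1 : ℝ) ≤ n * w := by exact_mod_cast h1
      have e2 : (n : ℝ) * w ≤ q.1 := by exact_mod_cast h2
      rw [toPlane, toPlane, e, ← hpq, ← Prod.image_mk_segment_left, segment_eq_Icc (e1.trans e2)]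
      exact ⟨_, ⟨e1, e2⟩, rfl⟩
    · simp only [Finset.forall_mem_image, Prod.fst_swap, Prod.snd_swap]
      exact (hΓ.properties hVΓ n (hdvd m hm)).2.2

/-- The three bounds for polygons of type II. -/
theorem IsTypeII.card_le {n : ℕ} (hn : 3 ≤ n) {P : Set (ℝ × ℝ)} (hT : IsTypeII n P)
    {V : Finset (ℤ × ℤ)} (hP : P = convexHull ℝ (toPlane '' V)) (hV : StrictlyExposed V) :
    V.card ≤ 2 * n + 2 ∧
    ∀ (m : ℕ) (Γ : Set (ℝ × ℝ)), n = m ∨ n = 2 * m → IsInvariantFactorLattice 1 m Γ →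
      toPlane '' V ⊆ Γ → V.card ≤ 2 * n ∧ (n = m → V.card ≤ 2 * n - 2) := by
  have hs := hT.splitBySquare hP
  have hn0 : (0 : ℤ) < n := by omega
  constructor
  · have := hs.two_mul_card_le hV 0 1 hn0 (by omega) (fun _ _ _ _ _ _ _ _ _ => le_rfl) le_rfl
      (by omega) (fun p hp q hq _ h => h) (fun p hp q hq _ h => h)
    omega
  · intro m Γ hm hΓ hVΓ
    have hmn : (m : ℤ) ∣ n := by
      rcases hm with rfl | rfl
      · exact dvd_rfl
      · exact ⟨2, by push_cast; ring⟩
    have hdvd := (hΓ.properties hVΓ n hmn).1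
    have hdet : ∀ p ∈ V, ∀ q ∈ V, ∀ a b : ℤ, (a = 0 ∨ a = n) → (b = 0 ∨ b = n) →
        ((p.1 - a) * (q.2 - b) - (p.2 - b) * (q.1 - a)).natAbs = 1 → (1 : ℤ) ≤ 0 := by
      intro p hp q hq a b ha hb h
      have ha' : (m : ℤ) ∣ a := by rcases ha with rfl | rfl <;> simp [hmn]
      have hb' : (m : ℤ) ∣ b := by rcases hb with rfl | rfl <;> simp [hmn]
      have h1 : (m : ℤ) ∣ (p.1 - a) * (q.2 - b) - (p.2 - b) * (q.1 - a) := by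
        -- Moving the origin to a corner changes the determinant by multiples of `m`, and `m ≥ 2`
        -- because `n ≥ 3`.
        have h2 : (p.1 - a) * (q.2 - b) - (p.2 - b) * (q.1 - a) =
            (p.1 * q.2 - p.2 * q.1) + a * (p.2 - q.2) + b * (q.1 - p.1) := by ring
        rw [h2]
        exact dvd_add (dvd_add (hdvd p hp q hq) (ha'.mul_right _)) (hb'.mul_right _)
      have h3 := Int.natCast_dvd.1 h1
      rw [h] at h3
      have := Nat.dvd_one.1 h3
      omega
    constructor
    · have := hs.two_mul_card_le hV 1 1 hn0 le_rfl hdet le_rfl (by omega)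
        (fun p hp q hq _ h => h) (fun p hp q hq _ h => h)
      omega
    · rintro rfl
      have := hs.two_mul_card_le hV 1 2 hn0 le_rfl hdet (by omega) le_rfl
        -- For vertices `p`, `q` one apart at equal height, the determinants with a vertex `r`
        -- beyond `x = n` differ by `r.2`. So `n` divides `r.2`, contradicting `0 < r.2 < n`.
        (fun p hp q hq h1 h2 => by
          by_contra hcon
          obtain ⟨r, hr, hr1⟩ := hs.right
          obtain ⟨h3, h4⟩ := hs.snd_mem hn0 hr hr1
          have h5 : (n : ℤ) ∣ r.2 := by
            have h6 := dvd_sub (hdvd q hq r hr) (hdvd p hp r hr)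
            rw [h1, show q.1 = p.1 + 1 by omega] at h6
            ring_nf at h6
            exact h6
          exact absurd (Int.le_of_dvd h3 h5) (not_le.2 h4))
        (fun p hp q hq h1 h2 => by
          by_contra hcon
          obtain ⟨r, hr, hr1⟩ := hs.top
          obtain ⟨h3, h4⟩ := hs.fst_mem hn0 hr hr1
          have h5 : (n : ℤ) ∣ r.1 := by
            have h6 := dvd_sub (hdvd p hp r hr) (hdvd q hq r hr)
            rw [h1, show q.2 = p.2 + 1 by omega] at h6
            ring_nf at h6
            exact h6
          exact absurd (Int.le_of_dvd h3 h5) (not_le.2 h4))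
      omega

theorem mainTheorem8 (n N : ℕ) (hn : 3 ≤ n) (P : Set (ℝ × ℝ))
    (hP : IsConvexIntegerGon N P) (hT : IsTypeI n P ∨ IsTypeII n P) :
    N ≤ 2 * n + 2 ∧
    (∀ (m : ℕ) (Γ : Set (ℝ × ℝ)), n = 2 * m → IsInvariantFactorLattice 1 m Γ →
      polygonVertices P ⊆ Γ → N ≤ 2 * n) ∧
    (∀ Γ : Set (ℝ × ℝ), IsInvariantFactorLattice 1 n Γ →
      polygonVertices P ⊆ Γ → N ≤ 2 * n - 2) := by
  obtain ⟨V, rfl, hverts, hhull, hV⟩ := hP.exists_vertices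
  rw [hverts]
  obtain ⟨h1, h2⟩ := hT.elim (fun h => h.card_le hn hhull hV) (fun h => h.card_le hn hhull hV)
  exact ⟨h1, fun m Γ hm hΓ hVΓ => (h2 m Γ (Or.inr hm) hΓ hVΓ).1,
    fun Γ hΓ hVΓ => (h2 n Γ (Or.inl rfl) hΓ hVΓ).2 rfl⟩
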